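/- **Languages.** Let $\mathsf P$ be a countably infinite set of variables. Formulas are built from variables by $\neg,\wedge,\Box_0,\Box,\forall$ and, in $\mathscr L^!$, by $[!\varphi]\psi$, in $\mathscr L^{\bullet}$ ($\bullet\in\{+,\Uparrow\}$) by $[\bullet\pi^*]\varphi$, where programs are $\pi::=A\mid{?\varphi}\mid\pi\cup\pi\mid\pi;\pi\mid\pi^*$ with $\varphi\in\mathscr L^\bullet$. Programs of the form $\pi^*$ are called evidence programs. $\bot,\top,\vee,\to,\leftrightarrow,\exists$ are the usual abbreviations ($\exists=\neg\forall\neg$). **Semantics.** A $\cap$-model $M=\langle W,\mathscr R,V\rangle$ consists of a non-empty set $W$, a set $\mathscr R$ of preorders on $W$ with $W^2\in\mathscr R$, and $V:\mathsf P\to 2^W$. Variables and Booleans are read as usual; $M,w\models\Box_0\varphi$ iff for some $R\in\mathscr R$ all $v$ with $Rwv$ satisfy $\varphi$; $M,w\models\Box\varphi$ iff all $v$ with $(w,v)\in\bigcap\mathscr R$ satisfy $\varphi$; $\forall$ is the universal modality. Programs denote relations as in $\mathsf{PDL}$, with $\llbracket A\rrbracket=W^2$. $M,w\models[!\varphi]\psi$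 iff $M,w\models\varphi$ implies $M',w\models\psi$ for the restriction $M'$ of $M$ to the states satisfying $\varphi$; $M,w\models[\bullet\pi]\varphi$ iff $M^{\bullet R},w\models\varphi$ with $R=\llbracket\pi\rrbracket_M$, where $M^{+R}$ has $\mathscr R\cup\{R\}$ in place of $\mathscr R$, and $M^{\Uparrow R}$ has $\{R^<\cup(R\cap R')\mid R'\in\mathscr R\}$ in place of $\mathscr R$, with $R^<=\{(x,y)\in R\mid(y,x)\notin R\}$ (satisfaction is defined by the same clauses for $\mathscr R$ that need not contain $W^2$). Validity is truth at all states of all $\cap$-models. **Normal forms.** For formulas $\varphi_i,\psi_i$ ($i\in I$, $I$ finite) let $S_0(I)$ be the finite set of non-empty sequences over $I$ of length at most $|I|$, and for $s\in S_0(I)$ let $s(\varphi,\psi)=\varphi_{s_1}\wedge\bigwedge_{k=2}^{\mathrm{len}(s)}\exists(\psi_{s_{k-1}}\wedge\varphi_{s_k})$ and $\psi_s=\psi_{s_{\mathrm{len}(s)}}$. The family gives a *normal form* for an evidence program $\pi$ if $\pi$ and $\bigcup_{s\in S_0(I)}(?s(\varphi,\psi);A;?\psi_s)\cup(?\top)$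 denote the same relation in every $\cap$-model. The *computed* normal form of $\rho^*$ is given by the family of the $\varphi_i,\psi_i$ in the form $\bigcup_i(?\varphi_i;A;?\psi_i)\cup(?\theta)$ of $\rho$, obtained by recursion: $A$ becomes $(?\top;A;?\top)\cup(?\bot)$, $?\varphi$ becomes $(?\bot;A;?\bot)\cup(?\varphi)$, unions are joined, compositions are distributed over unions, and starred programs become the displayed union. **Systems.** $\mathsf L$ has all propositional tautologies, $\mathsf{S5}$ for $\forall$, $\mathsf{S4}$ for $\Box$, $\Box_0\varphi\to\Box_0\Box_0\varphi$, $\forall\varphi\to\Box_0\varphi$, $(\Box_0\varphi\wedge\forall\psi)\leftrightarrow\Box_0(\varphi\wedge\forall\psi)$, $\Box_0\varphi\to\Box\varphi$, modus ponens, necessitation for $\forall$ and $\Box$, and the rule from $\varphi\to\psi$ infer $\Box_0\varphi\to\Box_0\psi$. Each of $\mathsf L^!,\mathsf L^+,\mathsf L^\Uparrow$ consists of $\mathsf L$ over the extended language, the rule of replacement of equivalents (from $\chi\leftrightarrow\chi'$ infer $[\cdot]\chi\leftrightarrow[\cdot]\chi'$) for its dynamic modalities $[\cdot]$, and the following axioms.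 - $\mathsf L^!$: $[!\varphi]p\leftrightarrow(\varphi\to p)$; $[!\varphi]\neg\psi\leftrightarrow(\varphi\to\neg[!\varphi]\psi)$; $[!\varphi](\psi\wedge\psi')\leftrightarrow[!\varphi]\psi\wedge[!\varphi]\psi'$; $[!\varphi]\Box_0\psi\leftrightarrow(\varphi\to\Box_0(\varphi\to[!\varphi]\psi))$; $[!\varphi]\Box\psi\leftrightarrow(\varphi\to\Box(\varphi\to[!\varphi]\psi))$; $[!\varphi]\forall\psi\leftrightarrow(\varphi\to\forall[!\varphi]\psi)$. - $\mathsf L^\bullet$, $\bullet\in\{+,\Uparrow\}$, for evidence programs $\pi$: $[\bullet\pi]p\leftrightarrow p$; $[\bullet\pi]\neg\chi\leftrightarrow\neg[\bullet\pi]\chi$; $[\bullet\pi](\chi\wedge\chi')\leftrightarrow[\bullet\pi]\chi\wedge[\bullet\pi]\chi'$; $[\bullet\pi]\forall\chi\leftrightarrow\forall[\bullet\pi]\chi$; and, for normal forms of $\pi$ given by $\varphi_i,\psi_i$ ($i\in I$): - $\mathsf L^+$: $[+\pi]\Box_0\chi\leftrightarrow\Box_0[+\pi]\chi\vee\big([+\pi]\chi\wedge\bigwedge_{s\in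 S_0(I)}(s(\varphi,\psi)\to\forall(\psi_s\to[+\pi]\chi))\big)$ and $[+\pi]\Box\chi\leftrightarrow[+\pi]\chi\wedge\bigwedge_{s\in S_0(I)}(s(\varphi,\psi)\to\Box(\psi_s\to[+\pi]\chi))$; - $\mathsf L^\Uparrow$: $[\Uparrow\pi]\Box_0\chi\leftrightarrow[\Uparrow\pi]\chi\wedge\pi^<(\chi)\wedge\pi^\cap(\chi)$ and $[\Uparrow\pi]\Box\chi\leftrightarrow[\Uparrow\pi]\chi\wedge\pi^<(\chi)\wedge\bigwedge_{s\in S_0(I)}(s(\varphi,\psi)\to\Box(\psi_s\to[\Uparrow\pi]\chi))$, where, with $J(\varphi)=\bigwedge_{j\in J}\varphi_j\wedge\bigwedge_{j\in I\setminus J}\neg\varphi_j$ and $J(\psi)$ likewise, $$\pi^\cap(\chi)=[\Uparrow\pi]\chi\wedge\bigvee_{J\subseteq I}\Big(J(\varphi)\wedge\Box_0\Big(\bigvee_{s\in S_0(I),\,s_1\in J}\big(\exists s(\varphi,\psi)\wedge\psi_s\big)\to[\Uparrow\pi]\chi\Big)\Big),$$ $$\pi^<(\chi)=\bigvee_{J\subseteq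 I}\Big(J(\psi)\wedge\bigwedge_{s\in S_0(I)}\Big(s(\varphi,\psi)\to\forall\Big(\Big(\psi_s\wedge\bigwedge_{s'\in S_0(I)}\big(s'(\varphi,\psi)\to\forall(\psi_{s'}\to\bigwedge_{j\in J}\neg\varphi_j)\big)\Big)\to[\Uparrow\pi]\chi\Big)\Big)\Big).$$ **Theorem.** $\mathsf L^!$, $\mathsf L^+$ and $\mathsf L^\Uparrow$ are sound and complete with respect to $\cap$-models: a formula of $\mathscr L^!$ (respectively $\mathscr L^+$, $\mathscr L^\Uparrow$) is a theorem of $\mathsf L^!$ (respectively $\mathsf L^+$, $\mathsf L^\Uparrow$) if and only if it is valid on all $\cap$-models. For $\mathsf L^+$ and $\mathsf L^\Uparrow$ this holds both when the axioms are taken for all normal forms of evidence programs and when they are taken for the computed normal forms only. -/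

import Mathlib

universe u

namespace RelEv

/-! ## Static connectives, shared by all the languages -/

/-- The formula constructors of the static language: variables `p` (indexed by `ℕ`), `¬`, `∧`,
`□₀`, `□` and `∀`.  The class only serves to write abbreviations and axiom schemata once for the
concrete dynamic languages below. -/
class StaticOps (F : Type) where
  atom : ℕ → F
  neg : F → F
  conj : F → F → F
  box0 : F → F
  box : F → F
  all : F → F

open StaticOps

section Abbreviations

variable {F : Type} [StaticOps F]

/-- `⊥ := p ∧ ¬p`, for a fixed variable `p`. -/
def bot : F := conj (atom 0) (neg (atom 0))

def top : F := neg bot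

def disj (a b : F) : F := neg (conj (neg a) (neg b))

def imp (a b : F) : F := neg (conj a (neg b))

def equ (a b : F) : F := conj (imp a b) (imp b a)

/-- `∃φ := ¬∀¬φ`. -/
def ex (a : F) : F := neg (all (neg a))

/-- Finite conjunction. -/
def bigConj (l : List F) : F := l.foldr conj top

/-- Finite disjunction. -/
def bigDisj (l : List F) : F := l.foldr disj bot

end Abbreviations

/-! ## The static proof system, and its extension by dynamic modalities -/

/-- Instances, in a language with the static connectives, of propositional tautologies: formulas
true under every assignment of truth values to formulas that respects `¬` and `∧`. -/
def Tautology {F : Type} [StaticOps F] (a : F) : Prop :=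
  ∀ v : F → Prop, (∀ b, v (neg b) ↔ ¬ v b) → (∀ b c, v (conj b c) ↔ (v b ∧ v c)) → v a

/-- The axioms of the static logic of intersection models. -/
inductive StaticAxiom {F : Type} [StaticOps F] : F → Prop
  | taut (a : F) : Tautology a → StaticAxiom a
  -- S5 for `∀`
  | allK (a b : F) : StaticAxiom (imp (all (imp a b)) (imp (all a) (all b)))
  | allT (a : F) : StaticAxiom (imp (all a) a)
  | all4 (a : F) : StaticAxiom (imp (all a) (all (all a)))
  | all5 (a : F) : StaticAxiom (imp (neg (all a)) (all (neg (all a))))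
  -- S4 for `□`
  | boxK (a b : F) : StaticAxiom (imp (box (imp a b)) (imp (box a) (box b)))
  | boxT (a : F) : StaticAxiom (imp (box a) a)
  | box4 (a : F) : StaticAxiom (imp (box a) (box (box a)))
  -- axiom 4 for `□₀`
  | box04 (a : F) : StaticAxiom (imp (box0 a) (box0 (box0 a)))
  -- universality for `□₀`
  | univ (a : F) : StaticAxiom (imp (all a) (box0 a))
  -- pullout
  | pullout (a b : F) : StaticAxiom (equ (conj (box0 a) (all b)) (box0 (conj a (all b))))
  | box0box (a : F) : StaticAxiom (imp (box0 a) (box a))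

/-- Theorems of the extension of the static logic by a family `D` of dynamic modalities and a set
`Red` of reduction axioms.  The last rule, replacement of equivalents under a dynamic modality,
is the rule on which the method of reduction axioms rests. -/
inductive Theorem {F ι : Type} [StaticOps F] (D : ι → F → F) (Red : F → Prop) : F → Prop
  | ax {a : F} : StaticAxiom a → Theorem D Red a
  | red {a : F} : Red a → Theorem D Red a
  | mp {a b : F} : Theorem D Red (imp a b) → Theorem D Red a → Theorem D Red b
  | necAll {a : F} : Theorem D Red a → Theorem D Red (all a)
  | necBox {a : F} : Theorem D Red a → Theorem D Red (box a)
  | monBox0 {a b : F} : Theorem D Red (imp a b) → Theorem D Red (imp (box0 a) (box0 b))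
  | replace (i : ι) {a b : F} : Theorem D Red (equ a b) → Theorem D Red (equ (D i a) (D i b))

/-! ## Intersection models and the three model transformers -/

/-- A set of states `W` with a family `ev` of relations and a valuation. -/
structure Model (W : Type u) where
  ev : Set (W → W → Prop)
  val : ℕ → Set W

/-- `R ∈ Pre(W)`. -/
def IsPre {W : Type u} (R : W → W → Prop) : Prop :=
  (∀ x, R x x) ∧ ∀ x y z, R x y → R y z → R x z

/-- `M` is a (relational evidence) model with the intersection rule as aggregator: there is a
state, the evidence orders are preorders, and the trivial evidence order `W²` is among them. -/
structure Model.IsCap {W : Type u} (M : Model W) : Prop where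
  nonempty : Nonempty W
  pre : ∀ R ∈ M.ev, IsPre R
  trivial_mem : (fun _ _ => True) ∈ M.ev

/-- The aggregated order `⋂ ev`. -/
def Model.agg {W : Type u} (M : Model W) (x y : W) : Prop := ∀ R ∈ M.ev, R x y

/-- Update: the restriction of the model to `P`. -/
def Model.update {W : Type u} (M : Model W) (P : Set W) : Model P where
  ev := {S | ∃ R ∈ M.ev, S = fun x y : P => R x y}
  val p := {x : P | (x : W) ∈ M.val p}

/-- Evidence addition. -/
def Model.add {W : Type u} (M : Model W) (R : W → W → Prop) : Model W where
  ev := M.ev ∪ {R}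
  val := M.val

/-- Evidence upgrade: every `R'` is replaced by `R^< ∪ (R ∩ R')`. -/
def Model.upgrade {W : Type u} (M : Model W) (R : W → W → Prop) : Model W where
  ev := {S | ∃ R' ∈ M.ev, S = fun x y => (R x y ∧ ¬ R y x) ∨ (R x y ∧ R' x y)}
  val := M.val

/-! ## Public announcements -/

/-- The language with modalities `[!φ]ψ`. -/
inductive AnnForm : Type
  | atom : ℕ → AnnForm
  | neg : AnnForm → AnnForm
  | conj : AnnForm → AnnForm → AnnForm
  | box0 : AnnForm → AnnForm
  | box : AnnForm → AnnForm
  | all : AnnForm → AnnForm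
  | ann : AnnForm → AnnForm → AnnForm

instance : StaticOps AnnForm where
  atom := AnnForm.atom
  neg := AnnForm.neg
  conj := AnnForm.conj
  box0 := AnnForm.box0
  box := AnnForm.box
  all := AnnForm.all

/-- Satisfaction. -/
def AnnForm.Sat : AnnForm → ∀ {W : Type u}, Model W → W → Prop
  | .atom p, _, M, w => w ∈ M.val p
  | .neg a, _, M, w => ¬ a.Sat M w
  | .conj a b, _, M, w => a.Sat M w ∧ b.Sat M w
  | .box0 a, _, M, w => ∃ R ∈ M.ev, ∀ v, R w v → a.Sat M v
  | .box a, _, M, w => ∀ v, M.agg w v → a.Sat M v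
  | .all a, _, M, _ => ∀ v, a.Sat M v
  | .ann a b, _, M, w => ∀ h : a.Sat M w, b.Sat (M.update {v | a.Sat M v}) ⟨w, h⟩

/-- Validity on intersection models. -/
def AnnForm.Valid (a : AnnForm) : Prop :=
  ∀ (W : Type u) (M : Model W), M.IsCap → ∀ w, a.Sat M w

/-- Reduction axioms for public announcements. -/
inductive AnnReduction : AnnForm → Prop
  | pa1 (a : AnnForm) (p : ℕ) :
      AnnReduction (equ (.ann a (.atom p)) (imp a (.atom p)))
  | pa2 (a b : AnnForm) :
      AnnReduction (equ (.ann a (.neg b)) (imp a (.neg (.ann a b))))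
  | pa3 (a b c : AnnForm) :
      AnnReduction (equ (.ann a (.conj b c)) (.conj (.ann a b) (.ann a c)))
  | pa4 (a b : AnnForm) :
      AnnReduction (equ (.ann a (.box0 b)) (imp a (.box0 (imp a (.ann a b)))))
  | pa5 (a b : AnnForm) :
      AnnReduction (equ (.ann a (.box b)) (imp a (.box (imp a (.ann a b)))))
  | pa6 (a b : AnnForm) :
      AnnReduction (equ (.ann a (.all b)) (imp a (.all (.ann a b))))

/-- Theoremhood in the logic of public announcements. -/
def AnnTheorem : AnnForm → Prop := Theorem AnnForm.ann AnnReduction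

/-! ## Evidence addition and evidence upgrade: languages and semantics -/

/-- The two evidential actions `+` and `⇑`. -/
inductive Action : Type
  | add
  | upgrade

mutual
/-- The language with modalities `[• π*]φ`; `dyn π φ` stands for `[• π*]φ`. -/
inductive Form (k : Action) : Type
  | atom : ℕ → Form k
  | neg : Form k → Form k
  | conj : Form k → Form k → Form k
  | box0 : Form k → Form k
  | box : Form k → Form k
  | all : Form k → Form k
  | dyn : Prog k → Form k → Form k
/-- Programs. -/
inductive Prog (k : Action) : Type
  | univ : Prog k
  | test : Form k → Prog k
  | union : Prog k → Prog k → Prog k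
  | seq : Prog k → Prog k → Prog k
  | star : Prog k → Prog k
end

instance (k : Action) : StaticOps (Form k) where
  atom := Form.atom
  neg := Form.neg
  conj := Form.conj
  box0 := Form.box0
  box := Form.box
  all := Form.all

/-- The transformation of a model by the action `k` with the relation `R`. -/
def Model.act {W : Type u} (M : Model W) : Action → (W → W → Prop) → Model W
  | .add, R => M.add R
  | .upgrade, R => M.upgrade R

mutual
/-- Satisfaction. -/
def Form.Sat {k : Action} : Form k → ∀ {W : Type u}, Model W → W → Prop
  | .atom p, _, M, w => w ∈ M.val p
  | .neg a, _, M, w => ¬ a.Sat M w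
  | .conj a b, _, M, w => a.Sat M w ∧ b.Sat M w
  | .box0 a, _, M, w => ∃ R ∈ M.ev, ∀ v, R w v → a.Sat M v
  | .box a, _, M, w => ∀ v, M.agg w v → a.Sat M v
  | .all a, _, M, _ => ∀ v, a.Sat M v
  | .dyn r a, _, M, w => a.Sat (M.act k (Relation.ReflTransGen (r.Rel M))) w
/-- The relation defined by a program. -/
def Prog.Rel {k : Action} : Prog k → ∀ {W : Type u}, Model W → W → W → Prop
  | .univ, _, _, _, _ => True
  | .test a, _, M, x, y => x = y ∧ a.Sat M x
  | .union r s, _, M, x, y => r.Rel M x y ∨ s.Rel M x y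
  | .seq r s, _, M, x, y => ∃ z, r.Rel M x z ∧ s.Rel M z y
  | .star r, _, M, x, y => Relation.ReflTransGen (r.Rel M) x y
end

/-- Validity on intersection models. -/
def Form.Valid {k : Action} (a : Form k) : Prop :=
  ∀ (W : Type u) (M : Model W), M.IsCap → ∀ w, a.Sat M w

/-- Equivalence of programs on intersection models. -/
def Prog.Equiv {k : Action} (r s : Prog k) : Prop :=
  ∀ (W : Type u) (M : Model W), M.IsCap → ∀ x y, r.Rel M x y ↔ s.Rel M x y

/-! ## Normal forms of programs -/

section NormalForm

variable {F : Type} [StaticOps F]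

/-- The sequences of length `m` over `I = {0, …, n-1}`. -/
def seqsOfLength (n : ℕ) : ℕ → List (List (Fin n))
  | 0 => [[]]
  | m + 1 => (List.finRange n).flatMap fun i => (seqsOfLength n m).map fun s => i :: s

/-- The non-empty sequences over `I = {0, …, n-1}` of length at most `n`; a sequence
`s₁, s₂, …` is given as the pair of `s₁` and `(s₂, …)`. -/
def S0 (n : ℕ) : List (Fin n × List (Fin n)) :=
  (List.finRange n).flatMap fun i =>
    (List.range n).flatMap fun m => (seqsOfLength n m).map fun s => (i, s)

/- A list `d` of pairs of formulas stands for the family `(φ_i, ψ_i)`, `i ∈ I`, indexed by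
the positions in the list. -/

def phi (d : List (F × F)) (i : Fin d.length) : F := (d.get i).1

def psi (d : List (F × F)) (i : Fin d.length) : F := (d.get i).2

/-- The formulas `∃(ψ_{s_{k-1}} ∧ φ_{s_k})` for `k ≥ 2`, where `i` is `s₁`. -/
def links (d : List (F × F)) : Fin d.length → List (Fin d.length) → List F
  | _, [] => []
  | i, j :: s => ex (conj (psi d i) (phi d j)) :: links d j s

/-- The formula `s(φ,ψ) = φ_{s₁} ∧ ⋀_{k ≥ 2} ∃(ψ_{s_{k-1}} ∧ φ_{s_k})`. -/
def seqForm (d : List (F × F)) (s : Fin d.length × List (Fin d.length)) : F :=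
  conj (phi d s.1) (bigConj (links d s.1 s.2))

/-- The formula `ψ_{s_len(s)}`. -/
def seqEnd (d : List (F × F)) (s : Fin d.length × List (Fin d.length)) : F :=
  psi d ((s.1 :: s.2).getLast (List.cons_ne_nil _ _))

/-- `J(φ) = ⋀_{j ∈ J} φ_j ∧ ⋀_{j ∈ I \ J} ¬φ_j`, for a family `f` in place of `φ`. -/
def exactly {n : ℕ} (f : Fin n → F) (J : List (Fin n)) : F :=
  conj (bigConj (J.map f))
    (bigConj (((List.finRange n).filter fun i => i ∉ J).map fun i => neg (f i)))

/-- The subsets of `I = {0, …, n-1}`. -/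
def subsets (n : ℕ) : List (List (Fin n)) := (List.finRange n).sublists

end NormalForm

/-- The program `⋃_{s ∈ S₀(I)} (?s(φ,ψ); A; ?ψ_{s_len(s)}) ∪ (?⊤)`. -/
def starNormalForm {k : Action} (d : List (Form k × Form k)) : Prog k :=
  ((S0 d.length).map fun s =>
    Prog.seq (.test (seqForm d s)) (.seq .univ (.test (seqEnd d s)))).foldr
      Prog.union (.test top)

/-- A normal form `⋃_{i ∈ I} (?φ_i; A; ?ψ_i) ∪ (?θ)` of a program, computed by recursion on the
program; it is returned as the list of the pairs `(φ_i, ψ_i)` together with `θ`. -/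
def Prog.normalForm {k : Action} : Prog k → List (Form k × Form k) × Form k
  | .univ => ([(top, top)], bot)
  | .test a => ([(bot, bot)], a)
  | .union r s => (r.normalForm.1 ++ s.normalForm.1, disj r.normalForm.2 s.normalForm.2)
  | .seq r s =>
      ((r.normalForm.1.flatMap fun p => s.normalForm.1.map fun q =>
          (conj p.1 (ex (conj p.2 q.1)), q.2))
        ++ (r.normalForm.1.map fun p => (p.1, conj p.2 s.normalForm.2))
        ++ (s.normalForm.1.map fun q => (conj r.normalForm.2 q.1, q.2)),
       conj r.normalForm.2 s.normalForm.2)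
  | .star r =>
      ((S0 r.normalForm.1.length).map fun s =>
          (seqForm r.normalForm.1 s, seqEnd r.normalForm.1 s),
       top)

/-- The family `d` gives a normal form for the evidence program `r*`. -/
def AnyNF {k : Action} (r : Prog k) (d : List (Form k × Form k)) : Prop :=
  Prog.Equiv.{u} (.star r) (starNormalForm d)

/-- The family `d` is the one that gives the computed normal form for the evidence program
`r*`. -/
def ComputedNF {k : Action} (r : Prog k) (d : List (Form k × Form k)) : Prop :=
  d = r.normalForm.1

/-! ## Reduction axioms for addition and upgrade -/

/-- The reduction axioms for evidence addition.  `N r d` says that the axioms are taken for the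
normal form of the evidence program `r*` that is given by `d`. -/
inductive AddReduction (N : Prog .add → List (Form .add × Form .add) → Prop) :
    Form .add → Prop
  | ea1 (r : Prog .add) (p : ℕ) :
      AddReduction N (equ (.dyn r (.atom p)) (.atom p))
  | ea2 (r : Prog .add) (c : Form .add) :
      AddReduction N (equ (.dyn r (.neg c)) (.neg (.dyn r c)))
  | ea3 (r : Prog .add) (c c' : Form .add) :
      AddReduction N (equ (.dyn r (.conj c c')) (.conj (.dyn r c) (.dyn r c')))
  | ea4 (r : Prog .add) (d : List (Form .add × Form .add)) (c : Form .add) : N r d →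
      AddReduction N (equ (.dyn r (.box0 c))
        (disj (.box0 (.dyn r c))
          (.conj (.dyn r c)
            (bigConj ((S0 d.length).map fun s =>
              imp (seqForm d s) (.all (imp (seqEnd d s) (.dyn r c))))))))
  | ea5 (r : Prog .add) (d : List (Form .add × Form .add)) (c : Form .add) : N r d →
      AddReduction N (equ (.dyn r (.box c))
        (.conj (.dyn r c)
          (bigConj ((S0 d.length).map fun s =>
            imp (seqForm d s) (.box (imp (seqEnd d s) (.dyn r c)))))))
  | ea6 (r : Prog .add) (c : Form .add) :
      AddReduction N (equ (.dyn r (.all c)) (.all (.dyn r c)))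

/-- The formula `π^∩(χ)`, where `e` is `[⇑π]χ`. -/
def piCap (d : List (Form .upgrade × Form .upgrade)) (e : Form .upgrade) : Form .upgrade :=
  .conj e
    (bigDisj ((subsets d.length).map fun J =>
      .conj (exactly (phi d) J)
        (.box0 (imp
          (bigDisj (((S0 d.length).filter fun s => s.1 ∈ J).map fun s =>
            .conj (ex (seqForm d s)) (seqEnd d s)))
          e))))

/-- The formula `suc^<(χ)` for the set `J`, where `e` is `[⇑π]χ`. -/
def sucLt (d : List (Form .upgrade × Form .upgrade)) (J : List (Fin d.length))
    (e : Form .upgrade) : Form .upgrade :=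
  bigConj ((S0 d.length).map fun s =>
    imp (seqForm d s)
      (.all (imp
        (.conj (seqEnd d s)
          (bigConj ((S0 d.length).map fun s' =>
            imp (seqForm d s')
              (.all (imp (seqEnd d s') (bigConj (J.map fun j => .neg (phi d j))))))))
        e)))

/-- The formula `π^<(χ)`, where `e` is `[⇑π]χ`. -/
def piLt (d : List (Form .upgrade × Form .upgrade)) (e : Form .upgrade) : Form .upgrade :=
  bigDisj ((subsets d.length).map fun J => .conj (exactly (psi d) J) (sucLt d J e))

/-- The reduction axioms for evidence upgrade.  `N r d` says that the axioms are taken for the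
normal form of the evidence program `r*` that is given by `d`. -/
inductive UpgradeReduction (N : Prog .upgrade → List (Form .upgrade × Form .upgrade) → Prop) :
    Form .upgrade → Prop
  | eu1 (r : Prog .upgrade) (p : ℕ) :
      UpgradeReduction N (equ (.dyn r (.atom p)) (.atom p))
  | eu2 (r : Prog .upgrade) (c : Form .upgrade) :
      UpgradeReduction N (equ (.dyn r (.neg c)) (.neg (.dyn r c)))
  | eu3 (r : Prog .upgrade) (c c' : Form .upgrade) :
      UpgradeReduction N (equ (.dyn r (.conj c c')) (.conj (.dyn r c) (.dyn r c')))
  | eu4 (r : Prog .upgrade) (d : List (Form .upgrade × Form .upgrade)) (c : Form .upgrade) :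
      N r d →
      UpgradeReduction N (equ (.dyn r (.box0 c))
        (.conj (.dyn r c) (.conj (piLt d (.dyn r c)) (piCap d (.dyn r c)))))
  | eu5 (r : Prog .upgrade) (d : List (Form .upgrade × Form .upgrade)) (c : Form .upgrade) :
      N r d →
      UpgradeReduction N (equ (.dyn r (.box c))
        (.conj (.dyn r c) (.conj (piLt d (.dyn r c))
          (bigConj ((S0 d.length).map fun s =>
            imp (seqForm d s) (.box (imp (seqEnd d s) (.dyn r c))))))))
  | eu6 (r : Prog .upgrade) (c : Form .upgrade) :
      UpgradeReduction N (equ (.dyn r (.all c)) (.all (.dyn r c)))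

/-- Theoremhood in the logic of evidence addition. -/
def AddTheorem (N : Prog .add → List (Form .add × Form .add) → Prop) : Form .add → Prop :=
  Theorem Form.dyn (AddReduction N)

/-- Theoremhood in the logic of evidence upgrade. -/
def UpgradeTheorem (N : Prog .upgrade → List (Form .upgrade × Form .upgrade) → Prop) :
    Form .upgrade → Prop :=
  Theorem Form.dyn (UpgradeReduction N)

end RelEv

/-!
Soundness holds on a larger class of models, those whose evidence is a non-empty family of preorders
(`Model.IsPreorders`).  This class, unlike that of intersection models, is closed under upgrade,
which the rule of replacement needs.  Evidence that contains other evidence is superfluous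
(`Form.sat_iff_of_weakens`).  Hence adding the trivial evidence changes nothing, and a normal form
on intersection models is one on the larger class (`isNF_of_anyNF`).

A sequence `s` in `S₀(I)` leads from `x` to `y` if `s(φ,ψ)` holds at `x` and `ψ_s` at `y`.  Since
paths can be freed of repetitions, such a sequence exists if and only if there is a path of any
length, with `i` linked to `j` when `∃(ψ_i ∧ φ_j)` (`exists_S0_iff_connected`).  Hence the computed
normal forms are normal forms (`anyNF_of_computedNF`), and the reduction axioms can be read off the
definitions, with one exception.  The formula `π^<(χ)` at `w` expresses that `v` does not lead back
to `w` by saying that it does not do so by a path with at least two members.  This is enough, since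
`w` leads to `v`: going round once more lengthens any path from `v` back to `w`
(`Connected.back_iff`).

For completeness, the reduction axioms for computed normal forms turn every formula into a
provably equivalent static one, by induction on formulas and programs (`AnnForm.reducible`,
`Form.reducible`), so that completeness of the static logic suffices (`StaticForm.thm_of_valid`).
The canonical worlds are the maximal consistent theories with the same `∀`-formulas, and `□` has its
usual canonical relation `≤`.  For each formula `□₀a` there is the preorder
`x ⊨ □₀a → y ⊨ □₀a`; by the pullout axiom, these preorders support the right formulas.  Their
intersection may be larger than `≤`.  The set of worlds is therefore doubled, and one preorder is
added for each of the two copies: it is `≤` within that copy, and every state sees along it the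
whole other copy.  The intersection then is `≤` within each copy, whereas the new preorders support
only formulas that are true everywhere.
-/

namespace RelEv

open StaticOps

/-! ### Propositional logic -/

section Propositional

variable {F : Type} [StaticOps F]

/-- An assignment of truth values to formulas that respects `¬` and `∧`. -/
structure IsVal (v : F → Prop) : Prop where
  neg : ∀ a, v (neg a) ↔ ¬ v a
  conj : ∀ a b, v (conj a b) ↔ (v a ∧ v b)

namespace IsVal

variable {v : F → Prop} (hv : IsVal v)

include hv

theorem bot : ¬ v bot := by simp [RelEv.bot, hv.neg, hv.conj]

theorem top : v top := by simp [RelEv.top, hv.neg, hv.bot]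

theorem disj (a b : F) : v (disj a b) ↔ (v a ∨ v b) := by
  simp only [RelEv.disj, hv.neg, hv.conj]; tauto

theorem imp (a b : F) : v (imp a b) ↔ (v a → v b) := by
  simp only [RelEv.imp, hv.neg, hv.conj]; tauto

theorem equ (a b : F) : v (equ a b) ↔ (v a ↔ v b) := by
  simp only [RelEv.equ, hv.imp, hv.conj]; tauto

theorem bigConj (l : List F) : v (bigConj l) ↔ ∀ a ∈ l, v a := by
  induction l with
  | nil => simpa [RelEv.bigConj] using hv.top
  | cons a l ih =>
    have h : v (RelEv.bigConj (a :: l)) ↔ v a ∧ v (RelEv.bigConj l) := hv.conj _ _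
    rw [h, ih, List.forall_mem_cons]

theorem bigDisj (l : List F) : v (bigDisj l) ↔ ∃ a ∈ l, v a := by
  induction l with
  | nil => simpa [RelEv.bigDisj] using hv.bot
  | cons a l ih =>
    have h : v (RelEv.bigDisj (a :: l)) ↔ v a ∨ v (RelEv.bigDisj l) := hv.disj _ _
    rw [h, ih, List.exists_mem_cons_iff]

end IsVal

theorem tautology_of_isVal {a : F} (h : ∀ v : F → Prop, IsVal v → v a) : Tautology a :=
  fun v hn hc => h v ⟨hn, hc⟩

/-- Derivability from a set of hypotheses by tautologies and modus ponens. -/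
inductive Deriv (Γ : Set F) : F → Prop
  | hyp {a : F} : a ∈ Γ → Deriv Γ a
  | taut {a : F} : Tautology a → Deriv Γ a
  | mp {a b : F} : Deriv Γ (imp a b) → Deriv Γ a → Deriv Γ b

namespace Deriv

theorem of_isVal {Γ : Set F} {a b : F} (h : ∀ v : F → Prop, IsVal v → v a → v b)
    (ha : Deriv Γ a) : Deriv Γ b :=
  mp (taut (tautology_of_isVal fun v hv => (hv.imp a b).2 (h v hv))) ha

theorem of_isVal₂ {Γ : Set F} {a b c : F} (h : ∀ v : F → Prop, IsVal v → v a → v b → v c)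
    (ha : Deriv Γ a) (hb : Deriv Γ b) : Deriv Γ c :=
  mp (of_isVal (fun v hv h' => (hv.imp b c).2 (h v hv h')) ha) hb

theorem deduction {Γ : Set F} {a b : F} (h : Deriv (insert b Γ) a) : Deriv Γ (imp b a) := by
  induction h with
  | @hyp a h =>
    rcases h with rfl | h
    · exact taut (tautology_of_isVal fun v hv => (hv.imp _ _).2 id)
    · exact of_isVal (fun v hv h' => (hv.imp _ _).2 fun _ => h') (hyp h)
  | @taut a h =>
    exact of_isVal (fun v hv h' => (hv.imp _ _).2 fun _ => h') (taut h)
  | mp _ _ ih₁ ih₂ =>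
    refine of_isVal₂ (fun v hv h₁ h₂ => ?_) ih₁ ih₂
    simp only [hv.imp] at *
    tauto

/-- A derivation uses finitely many hypotheses, hence only one member of a chain of sets. -/
theorem exists_of_sUnion {c : Set (Set F)} (hc : IsChain (· ⊆ ·) c) (hne : c.Nonempty) {a : F}
    (h : Deriv (⋃₀ c) a) : ∃ Γ ∈ c, Deriv Γ a := by
  have mono : ∀ {Γ Δ : Set F} {a : F}, Γ ⊆ Δ → Deriv Γ a → Deriv Δ a := by
    intro Γ Δ a hs h
    induction h with
    | hyp h => exact hyp (hs h)
    | taut h => exact taut h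
    | mp _ _ ih₁ ih₂ => exact mp ih₁ ih₂
  induction h with
  | hyp h => exact ⟨_, h.choose_spec.1, hyp h.choose_spec.2⟩
  | taut h => exact ⟨_, hne.choose_spec, taut h⟩
  | mp _ _ ih₁ ih₂ =>
    obtain ⟨Γ, hΓ, h₁⟩ := ih₁
    obtain ⟨Δ, hΔ, h₂⟩ := ih₂
    rcases hc.total hΓ hΔ with hs | hs
    · exact ⟨Δ, hΔ, mp (mono hs h₁) h₂⟩
    · exact ⟨Γ, hΓ, mp h₁ (mono hs h₂)⟩

/-- Lindenbaum's lemma.  The valuation is derivability from a set that is maximal among those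
that extend `Γ` and do not derive `a`. -/
theorem lindenbaum {Γ : Set F} {a : F} (h : ¬ Deriv Γ a) :
    ∃ v : F → Prop, IsVal v ∧ (∀ b ∈ Γ, v b) ∧ ¬ v a := by
  obtain ⟨Δ, hΓ, hΔ⟩ := zorn_subset_nonempty {Δ : Set F | ¬ Deriv Δ a}
    (fun c hc hch hne => ⟨⋃₀ c,
      fun hd => by
        obtain ⟨Δ, hΔ, hd⟩ := exists_of_sUnion hch hne hd
        exact hc hΔ hd,
      fun s hs => Set.subset_sUnion_of_mem hs⟩) Γ h
  have hna : ¬ Deriv Δ a := hΔ.prop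
  have key : ∀ b, ¬ Deriv Δ b → Deriv Δ (imp b a) := by
    intro b hb
    by_contra hba
    have hins : insert b Δ ∈ {Δ : Set F | ¬ Deriv Δ a} := fun hd => hba hd.deduction
    exact hb (hyp (hΔ.le_of_ge hins (Set.subset_insert _ _) (Set.mem_insert _ _)))
  refine ⟨Deriv Δ, ⟨fun b => ⟨fun hn hb => ?_, fun hb => ?_⟩, fun b c => ⟨fun hbc => ⟨?_, ?_⟩,
    fun hbc => ?_⟩⟩, fun b hb => hyp (hΓ hb), hna⟩
  · exact hna (of_isVal₂ (fun v hv h₁ h₂ => absurd h₂ ((hv.neg b).1 h₁)) hn hb)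
  · by_contra hn
    refine hna (of_isVal₂ (fun v hv h₁ h₂ => ?_) (key _ hb) (key _ hn))
    simp only [hv.imp, hv.neg] at h₁ h₂
    tauto
  · exact of_isVal (fun v hv h => ((hv.conj _ _).1 h).1) hbc
  · exact of_isVal (fun v hv h => ((hv.conj _ _).1 h).2) hbc
  · exact of_isVal₂ (fun v hv h₁ h₂ => (hv.conj _ _).2 ⟨h₁, h₂⟩) hbc.1 hbc.2

end Deriv

/-! ### Derived rules of the proof systems -/

namespace Theorem

variable {ι : Type} {D : ι → F → F} {Red : F → Prop}

theorem of_deriv {a : F} (h : Deriv {b | Theorem D Red b} a) : Theorem D Red a := by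
  induction h with
  | hyp h => exact h
  | taut h => exact ax (.taut _ h)
  | mp _ _ ih₁ ih₂ => exact mp ih₁ ih₂

/-- Propositional consequences of theorems are theorems. -/
theorem of_isVal {a : F}
    (h : ∀ v : F → Prop, IsVal v → (∀ b, Theorem D Red b → v b) → v a) : Theorem D Red a := by
  by_contra ha
  obtain ⟨v, hv, hT, hva⟩ := Deriv.lindenbaum fun hd => ha (of_deriv hd)
  exact hva (h v hv hT)

theorem mp_equ {a b : F} (h : Theorem D Red (equ a b)) (hb : Theorem D Red b) :
    Theorem D Red a :=
  of_isVal fun _ hv hT => ((hv.equ _ _).1 (hT _ h)).2 (hT _ hb)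

theorem equ_trans {a b c : F} (h₁ : Theorem D Red (equ a b)) (h₂ : Theorem D Red (equ b c)) :
    Theorem D Red (equ a c) :=
  of_isVal fun _ hv hT =>
    (hv.equ _ _).2 (((hv.equ _ _).1 (hT _ h₁)).trans ((hv.equ _ _).1 (hT _ h₂)))

theorem neg_congr {a b : F} (h : Theorem D Red (equ a b)) :
    Theorem D Red (equ (neg a) (neg b)) :=
  of_isVal fun _ hv hT => by
    rw [hv.equ, hv.neg, hv.neg, (hv.equ _ _).1 (hT _ h)]

theorem conj_congr {a b c d : F} (h₁ : Theorem D Red (equ a b)) (h₂ : Theorem D Red (equ c d)) :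
    Theorem D Red (equ (conj a c) (conj b d)) :=
  of_isVal fun _ hv hT => by
    rw [hv.equ, hv.conj, hv.conj, (hv.equ _ _).1 (hT _ h₁), (hv.equ _ _).1 (hT _ h₂)]

/-- A monotone operator respects provable equivalence. -/
theorem congr_of_mono {f : F → F}
    (hf : ∀ {a b : F}, Theorem D Red (imp a b) → Theorem D Red (imp (f a) (f b)))
    {a b : F} (h : Theorem D Red (equ a b)) : Theorem D Red (equ (f a) (f b)) := by
  have h₁ : Theorem D Red (imp a b) :=
    of_isVal fun _ hv hT => (hv.imp _ _).2 ((hv.equ _ _).1 (hT _ h)).1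
  have h₂ : Theorem D Red (imp b a) :=
    of_isVal fun _ hv hT => (hv.imp _ _).2 ((hv.equ _ _).1 (hT _ h)).2
  exact of_isVal fun _ hv hT => (hv.equ _ _).2
    ⟨(hv.imp _ _).1 (hT _ (hf h₁)), (hv.imp _ _).1 (hT _ (hf h₂))⟩

theorem box_mono {a b : F} (h : Theorem D Red (imp a b)) :
    Theorem D Red (imp (box a) (box b)) :=
  mp (ax (.boxK _ _)) (necBox h)

theorem all_mono {a b : F} (h : Theorem D Red (imp a b)) :
    Theorem D Red (imp (all a) (all b)) :=
  mp (ax (.allK _ _)) (necAll h)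

end Theorem

end Propositional

/-! ### Static semantics and soundness -/

/-- A family of preorders that is non-empty, but need not contain the trivial one.  Upgrade
preserves this class of models; it does not preserve the class of intersection models. -/
structure Model.IsPreorders {W : Type u} (M : Model W) : Prop where
  pre : ∀ R ∈ M.ev, IsPre R
  ev_nonempty : M.ev.Nonempty

theorem Model.IsCap.isPreorders {W : Type u} {M : Model W} (h : M.IsCap) : M.IsPreorders :=
  ⟨h.pre, _, h.trivial_mem⟩

/-- `sat` interprets the static connectives in the model `M`. -/
structure IsStaticSat {F : Type} [StaticOps F] {W : Type u} (M : Model W)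
    (sat : F → W → Prop) : Prop where
  atom : ∀ p w, sat (atom p) w ↔ w ∈ M.val p
  neg : ∀ a w, sat (neg a) w ↔ ¬ sat a w
  conj : ∀ a b w, sat (conj a b) w ↔ (sat a w ∧ sat b w)
  box0 : ∀ a w, sat (box0 a) w ↔ ∃ R ∈ M.ev, ∀ v, R w v → sat a v
  box : ∀ a w, sat (box a) w ↔ ∀ v, M.agg w v → sat a v
  all : ∀ a w, sat (all a) w ↔ ∀ v, sat a v

namespace IsStaticSat

variable {F : Type} [StaticOps F] {W : Type u} {M : Model W} {sat : F → W → Prop}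

theorem isVal (hs : IsStaticSat M sat) (w : W) : IsVal fun a => sat a w :=
  ⟨fun a => hs.neg a w, fun a b => hs.conj a b w⟩

theorem bot (hs : IsStaticSat M sat) (w : W) : sat bot w ↔ False :=
  iff_false_intro (hs.isVal w).bot

theorem top (hs : IsStaticSat M sat) (w : W) : sat top w ↔ True :=
  iff_true_intro (hs.isVal w).top

theorem imp (hs : IsStaticSat M sat) (a b : F) (w : W) :
    sat (imp a b) w ↔ (sat a w → sat b w) := (hs.isVal w).imp a b

theorem disj (hs : IsStaticSat M sat) (a b : F) (w : W) :
    sat (disj a b) w ↔ (sat a w ∨ sat b w) := (hs.isVal w).disj a b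

theorem equ (hs : IsStaticSat M sat) (a b : F) (w : W) :
    sat (equ a b) w ↔ (sat a w ↔ sat b w) := (hs.isVal w).equ a b

theorem bigConj (hs : IsStaticSat M sat) (l : List F) (w : W) :
    sat (bigConj l) w ↔ ∀ a ∈ l, sat a w := (hs.isVal w).bigConj l

theorem bigDisj (hs : IsStaticSat M sat) (l : List F) (w : W) :
    sat (bigDisj l) w ↔ ∃ a ∈ l, sat a w := (hs.isVal w).bigDisj l

theorem ex (hs : IsStaticSat M sat) (a : F) (w : W) : sat (ex a) w ↔ ∃ v, sat a v := by
  simp [RelEv.ex, hs.neg, hs.all]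

theorem staticAxiom_sound (hs : IsStaticSat M sat) (hM : M.IsPreorders) {a : F}
    (ha : StaticAxiom a) (w : W) : sat a w := by
  cases ha with
  | taut a h => exact h (fun a => sat a w) (hs.isVal w).neg (hs.isVal w).conj
  | allK a b => simp only [hs.imp, hs.all]; exact fun h h' v => h v (h' v)
  | allT a => simp only [hs.imp, hs.all]; exact fun h => h w
  | all4 a => simp only [hs.imp, hs.all]; exact fun h _ => h
  | all5 a => simp only [hs.imp, hs.all, hs.neg]; exact fun h _ => h
  | boxK a b => simp only [hs.imp, hs.box]; exact fun h h' v hv => h v hv (h' v hv)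
  | boxT a =>
    simp only [hs.imp, hs.box]
    exact fun h => h w fun R hR => (hM.pre R hR).1 w
  | box4 a =>
    simp only [hs.imp, hs.box]
    exact fun h v hv u hu => h u fun R hR => (hM.pre R hR).2 _ _ _ (hv R hR) (hu R hR)
  | box04 a =>
    simp only [hs.imp, hs.box0]
    exact fun ⟨R, hR, h⟩ => ⟨R, hR, fun v hv => ⟨R, hR, fun u hu =>
      h u ((hM.pre R hR).2 _ _ _ hv hu)⟩⟩
  | univ a =>
    simp only [hs.imp, hs.all, hs.box0]
    exact fun h => ⟨_, hM.ev_nonempty.choose_spec, fun v _ => h v⟩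
  | pullout a b =>
    simp only [hs.equ, hs.conj, hs.all, hs.box0]
    exact ⟨fun ⟨⟨R, hR, h⟩, h'⟩ => ⟨R, hR, fun v hv => ⟨h v hv, h'⟩⟩,
      fun ⟨R, hR, h⟩ => ⟨⟨R, hR, fun v hv => (h v hv).1⟩, (h w ((hM.pre R hR).1 w)).2⟩⟩
  | box0box a =>
    simp only [hs.imp, hs.box0, hs.box]
    exact fun ⟨R, hR, h⟩ v hv => h v (hv R hR)

end IsStaticSat

/-- Soundness of a proof system, given that of its reduction axioms and of replacement. -/
theorem Theorem.sound {F ι : Type} [StaticOps F] {D : ι → F → F} {Red : F → Prop}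
    {sat : F → ∀ {W : Type u}, Model W → W → Prop}
    (hs : ∀ {W : Type u} (M : Model W), IsStaticSat M fun a => sat a M)
    (hred : ∀ a, Red a → ∀ {W : Type u} (M : Model W), M.IsPreorders → ∀ w, sat a M w)
    (hrep : ∀ i a b, (∀ {W : Type u} (M : Model W), M.IsPreorders → ∀ w, sat a M w ↔ sat b M w) →
      ∀ {W : Type u} (M : Model W), M.IsPreorders → ∀ w, sat (D i a) M w ↔ sat (D i b) M w)
    {a : F} (h : Theorem D Red a) :
    ∀ {W : Type u} (M : Model W), M.IsPreorders → ∀ w, sat a M w := by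
  induction h with
  | ax h => exact fun M hM w => (hs M).staticAxiom_sound hM h w
  | red h => exact hred _ h
  | mp _ _ ih₁ ih₂ => exact fun M hM w => ((hs M).imp _ _ w).1 (ih₁ M hM w) (ih₂ M hM w)
  | necAll _ ih => exact fun M hM w => ((hs M).all _ w).2 fun v => ih M hM v
  | necBox _ ih => exact fun M hM w => ((hs M).box _ w).2 fun v _ => ih M hM v
  | monBox0 _ ih =>
    intro W M hM w
    refine ((hs M).imp _ _ w).2 fun h => ?_
    obtain ⟨R, hR, h⟩ := ((hs M).box0 _ w).1 h
    exact ((hs M).box0 _ w).2 ⟨R, hR, fun v hv => ((hs M).imp _ _ v).1 (ih M hM v) (h v hv)⟩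
  | replace i _ ih =>
    exact fun M hM w => ((hs M).equ _ _ w).2
      (hrep i _ _ (fun M hM w => ((hs M).equ _ _ w).1 (ih M hM w)) M hM w)

/-! ### The static language -/

/-- The static language, without dynamic modalities. -/
inductive StaticForm : Type
  | atom : ℕ → StaticForm
  | neg : StaticForm → StaticForm
  | conj : StaticForm → StaticForm → StaticForm
  | box0 : StaticForm → StaticForm
  | box : StaticForm → StaticForm
  | all : StaticForm → StaticForm

instance : StaticOps StaticForm where
  atom := StaticForm.atom
  neg := StaticForm.neg
  conj := StaticForm.conj
  box0 := StaticForm.box0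
  box := StaticForm.box
  all := StaticForm.all

namespace StaticForm

/-- Satisfaction. -/
def Sat {W : Type u} (M : Model W) : StaticForm → W → Prop
  | .atom p, w => w ∈ M.val p
  | .neg a, w => ¬ a.Sat M w
  | .conj a b, w => a.Sat M w ∧ b.Sat M w
  | .box0 a, w => ∃ R ∈ M.ev, ∀ v, R w v → a.Sat M v
  | .box a, w => ∀ v, M.agg w v → a.Sat M v
  | .all a, _ => ∀ v, a.Sat M v

/-- Theoremhood in the static logic: there are no dynamic modalities and no reduction axioms. -/
abbrev Thm : StaticForm → Prop := Theorem (ι := Empty) (fun _ a => a) fun _ => False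

section Embedding

variable {F : Type} [StaticOps F]

/-- The embedding of the static language into a language with the static connectives. -/
def embed : StaticForm → F
  | .atom p => StaticOps.atom p
  | .neg a => StaticOps.neg a.embed
  | .conj a b => StaticOps.conj a.embed b.embed
  | .box0 a => StaticOps.box0 a.embed
  | .box a => StaticOps.box a.embed
  | .all a => StaticOps.all a.embed

theorem sat_embed {W : Type u} {M : Model W} {sat : F → W → Prop} (hs : IsStaticSat M sat)
    (a : StaticForm) : ∀ w, sat a.embed w ↔ a.Sat M w := by
  induction a with
  | atom p => exact hs.atom p
  | neg a ih => exact fun w => (hs.neg _ w).trans (not_congr (ih w))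
  | conj a b iha ihb => exact fun w => (hs.conj _ _ w).trans (and_congr (iha w) (ihb w))
  | box0 a ih => intro w; simp only [embed, hs.box0, ih, Sat]
  | box a ih => intro w; simp only [embed, hs.box, ih, Sat]
  | all a ih => intro w; simp only [embed, hs.all, ih, Sat]

theorem Thm.embed {ι : Type} {D : ι → F → F} {Red : F → Prop} {a : StaticForm} (h : Thm a) :
    Theorem D Red (a.embed : F) := by
  induction h with
  | ax h =>
    cases h with
    | taut a h =>
      exact .ax (.taut _ fun v hn hc =>
        h (fun b => v b.embed) (fun b => hn b.embed) fun b c => hc b.embed c.embed)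
    | allK => exact .ax (.allK _ _)
    | allT => exact .ax (.allT _)
    | all4 => exact .ax (.all4 _)
    | all5 => exact .ax (.all5 _)
    | boxK => exact .ax (.boxK _ _)
    | boxT => exact .ax (.boxT _)
    | box4 => exact .ax (.box4 _)
    | box04 => exact .ax (.box04 _)
    | univ => exact .ax (.univ _)
    | pullout => exact .ax (.pullout _ _)
    | box0box => exact .ax (.box0box _)
  | red h => exact h.elim
  | mp _ _ ih₁ ih₂ => exact .mp ih₁ ih₂
  | necAll _ ih => exact .necAll ih
  | necBox _ ih => exact .necBox ih
  | monBox0 _ ih => exact .monBox0 ih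
  | replace i => exact i.elim

end Embedding

/-! ### The canonical model of the static logic -/

/-- A maximal consistent theory, given as a valuation. -/
structure IsTheory (v : StaticForm → Prop) : Prop where
  isVal : IsVal v
  thm : ∀ a, Thm a → v a

namespace IsTheory

variable {v : StaticForm → Prop} (hv : IsTheory v)

include hv

theorem mp {a b : StaticForm} (h : Thm (RelEv.imp a b)) (ha : v a) : v b :=
  (hv.isVal.imp a b).1 (hv.thm _ h) ha

theorem all_of_deriv {a : StaticForm} (h : Deriv {b | v (.all b)} a) : v (.all a) := by
  induction h with
  | hyp h => exact h
  | taut h => exact hv.thm _ (.necAll (.ax (.taut _ h)))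
  | mp _ _ ih₁ ih₂ => exact (hv.isVal.imp _ _).1 (hv.mp (.ax (.allK _ _)) ih₁) ih₂

theorem box_of_deriv {a : StaticForm} (h : Deriv {b | v (.box b)} a) : v (.box a) := by
  induction h with
  | hyp h => exact h
  | taut h => exact hv.thm _ (.necBox (.ax (.taut _ h)))
  | mp _ _ ih₁ ih₂ => exact (hv.isVal.imp _ _).1 (hv.mp (.ax (.boxK _ _)) ih₁) ih₂

theorem box0_of_all {a : StaticForm} (h : v (.all a)) : v (.box0 a) := hv.mp (.ax (.univ a)) h

theorem box_of_all {a : StaticForm} (h : v (.all a)) : v (.box a) :=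
  hv.mp (.ax (.box0box a)) (hv.box0_of_all h)

theorem all_neg_all {a : StaticForm} (h : ¬ v (.all a)) : v (.all (.neg (.all a))) :=
  hv.mp (.ax (.all5 a)) ((hv.isVal.neg _).2 h)

/-- The pullout axiom makes `□₀` monotone under implications that hold everywhere. -/
theorem box0_mono {a b : StaticForm} (h : v (.all (RelEv.imp a b))) (ha : v (.box0 a)) :
    v (.box0 b) := by
  have h₁ : v (.box0 (.conj a (.all (RelEv.imp a b)))) :=
    ((hv.isVal.equ _ _).1 (hv.thm _ (.ax (.pullout a (RelEv.imp a b))))).1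
      ((hv.isVal.conj _ _).2 ⟨ha, h⟩)
  refine hv.mp (.monBox0 (.of_isVal fun u hu hT => ?_)) h₁
  refine (hu.imp _ _).2 fun h' => ?_
  obtain ⟨h₂, h₃⟩ := (hu.conj _ _).1 h'
  exact (hu.imp _ _).1 ((hu.imp _ _).1 (hT _ (.ax (.allT _))) h₃) h₂

/-- The existence lemma for `∀` and `□`.  By `S5`, a theory that extends `{b | ∀b ∈ v}` has the same
`∀`-formulas as `v`. -/
theorem exists_theory {Γ : Set StaticForm} {a : StaticForm} (ha : ¬ Deriv Γ a)
    (hΓ : ∀ b, v (.all b) → b ∈ Γ) :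
    ∃ u, IsTheory u ∧ (∀ b, u (.all b) ↔ v (.all b)) ∧ (∀ b ∈ Γ, u b) ∧ ¬ u a := by
  obtain ⟨u, hu, huΓ, hua⟩ := Deriv.lindenbaum ha
  refine ⟨u, ⟨hu, fun b hb => huΓ _ (hΓ _ (hv.thm _ (.necAll hb)))⟩, fun b => ⟨fun h => ?_,
    fun h => huΓ _ (hΓ _ (hv.mp (.ax (.all4 _)) h))⟩, huΓ, hua⟩
  by_contra hb
  exact (hu.neg _).1 (huΓ _ (hΓ _ (hv.all_neg_all hb))) h

end IsTheory

/-- The theories that have the same `∀`-formulas as `v`. -/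
structure World (v : StaticForm → Prop) where
  holds : StaticForm → Prop
  isTheory : IsTheory holds
  all_iff : ∀ a, holds (.all a) ↔ v (.all a)

section Canonical

variable {v : StaticForm → Prop}

theorem World.all_holds (hv : IsTheory v) (x : World v) (a : StaticForm) :
    x.holds (.all a) ↔ ∀ y : World v, y.holds a := by
  refine ⟨fun h y => y.isTheory.mp (.ax (.allT a)) ((y.all_iff a).2 ((x.all_iff a).1 h)),
    fun h => ?_⟩
  by_contra ha
  obtain ⟨u, hu, hall, _, hua⟩ := hv.exists_theory (Γ := {b | v (.all b)}) (a := a)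
    (fun hd => ha ((x.all_iff a).2 (hv.all_of_deriv hd))) fun _ hb => hb
  exact hua (h ⟨u, hu, hall⟩)

/-- The canonical accessibility relation of `□`. -/
def World.le (x y : World v) : Prop := ∀ a, x.holds (.box a) → y.holds a

theorem World.le_refl (x : World v) : x.le x := fun a h => x.isTheory.mp (.ax (.boxT a)) h

theorem World.le_trans {x y z : World v} (h : x.le y) (h' : y.le z) : x.le z :=
  fun a ha => h' a (h _ (x.isTheory.mp (.ax (.box4 a)) ha))

theorem World.box_holds (x : World v) (a : StaticForm) :
    x.holds (.box a) ↔ ∀ y : World v, x.le y → y.holds a := by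
  refine ⟨fun h y hy => hy a h, fun h => ?_⟩
  by_contra ha
  obtain ⟨u, hu, hall, hΓ, hua⟩ := x.isTheory.exists_theory
    (Γ := {b | x.holds (.box b)}) (a := a)
    (fun hd => ha (x.isTheory.box_of_deriv hd)) fun b hb => x.isTheory.box_of_all hb
  exact hua (h ⟨u, hu, fun b => (hall b).trans (x.all_iff b)⟩ hΓ)

theorem World.box0_of_le {x y : World v} (h : x.le y) {a : StaticForm}
    (ha : x.holds (.box0 a)) : y.holds (.box0 a) :=
  h _ (x.isTheory.mp (.ax (.box0box _)) (x.isTheory.mp (.ax (.box04 a)) ha))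

theorem World.box0_elim (x : World v) {a : StaticForm} (ha : x.holds (.box0 a)) : x.holds a :=
  x.isTheory.mp (.ax (.boxT a)) (x.isTheory.mp (.ax (.box0box a)) ha)

/-- The evidence in the canonical model, which consists of two copies of the set of worlds.
Besides the trivial order there are the orders of the truth sets of the formulas `□₀a`, and two
orders `guard k` that are `≤` within the copy `k`, are total on the other copy, and lead only from
copy `k` to the other one.  The orders `guard k` cut the intersection of all the evidence down to
`≤`, but, as every state sees a whole copy along each of them, they support no formula under
`□₀` that is not true everywhere. -/
inductive Evidence : Type
  | trivial
  | supports (a : StaticForm)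
  | guard (k : Bool)

/-- The relation that is named by a piece of evidence. -/
def Evidence.Rel : Evidence → World v × Bool → World v × Bool → Prop
  | .trivial, _, _ => True
  | .supports a, x, y => x.1.holds (.box0 a) → y.1.holds (.box0 a)
  | .guard k, x, y => y.2 = k → x.2 = k ∧ x.1.le y.1

theorem Evidence.isPre (e : Evidence) : IsPre (e.Rel (v := v)) := by
  cases e with
  | trivial => exact ⟨fun _ => True.intro, fun _ _ _ _ _ => True.intro⟩
  | supports a => exact ⟨fun _ => id, fun _ _ _ h h' => h' ∘ h⟩
  | guard k =>
    refine ⟨fun x hk => ⟨hk, x.1.le_refl⟩, fun x y z h h' hz => ?_⟩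
    obtain ⟨hy, hyz⟩ := h' hz
    obtain ⟨hx, hxy⟩ := h hy
    exact ⟨hx, World.le_trans hxy hyz⟩

variable (v) in
/-- The canonical model, lifted to an arbitrary universe. -/
def canonicalModel : Model (ULift.{u} (World v × Bool)) where
  ev := {S | ∃ e : Evidence, S = fun x y => e.Rel x.down y.down}
  val p := {x | x.down.1.holds (.atom p)}

theorem canonicalModel_isCap (hv : IsTheory v) : (canonicalModel.{u} v).IsCap where
  nonempty := ⟨⟨⟨v, hv, fun _ => Iff.rfl⟩, true⟩⟩
  pre := by
    rintro _ ⟨e, rfl⟩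
    exact ⟨fun x => e.isPre.1 x.down, fun x y z => e.isPre.2 x.down y.down z.down⟩
  trivial_mem := ⟨.trivial, rfl⟩

theorem canonicalModel_agg (x y : ULift.{u} (World v × Bool)) :
    (canonicalModel v).agg x y ↔ x.down.2 = y.down.2 ∧ x.down.1.le y.down.1 := by
  constructor
  · exact fun h => h _ ⟨.guard y.down.2, rfl⟩ rfl
  · rintro ⟨h, hle⟩ _ ⟨e, rfl⟩
    cases e with
    | trivial => exact True.intro
    | supports a => exact World.box0_of_le hle
    | guard k => exact fun hk => ⟨h.trans hk, hle⟩

theorem truth_lemma (hv : IsTheory v) (a : StaticForm) :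
    ∀ x : ULift.{u} (World v × Bool), a.Sat (canonicalModel v) x ↔ x.down.1.holds a := by
  induction a with
  | atom p => exact fun x => Iff.rfl
  | neg a ih =>
    exact fun x => (not_congr (ih x)).trans (x.down.1.isTheory.isVal.neg a).symm
  | conj a b iha ihb =>
    exact fun x => (and_congr (iha x) (ihb x)).trans (x.down.1.isTheory.isVal.conj a b).symm
  | box a ih =>
    intro x
    simp only [Sat, ih, canonicalModel_agg, World.box_holds]
    exact ⟨fun h y hy => h ⟨(y, x.down.2)⟩ ⟨rfl, hy⟩, fun h y hy => h _ hy.2⟩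
  | all a ih =>
    intro x
    simp only [Sat, ih, World.all_holds hv]
    exact ⟨fun h y => h ⟨(y, true)⟩, fun h y => h _⟩
  | box0 a ih =>
    intro x
    simp only [Sat, ih]
    constructor
    · rintro ⟨_, ⟨e, rfl⟩, h⟩
      cases e with
      | trivial =>
        exact x.down.1.isTheory.box0_of_all
          ((World.all_holds hv _ a).2 fun y => h ⟨(y, true)⟩ True.intro)
      | guard k =>
        refine x.down.1.isTheory.box0_of_all
          ((World.all_holds hv _ a).2 fun y => h ⟨(y, !k)⟩ fun hk => ?_)
        cases k <;> cases hk
      | supports b =>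
        by_cases hb : x.down.1.holds (.box0 b)
        · refine x.down.1.isTheory.box0_mono (a := .box0 b) ?_
            (x.down.1.isTheory.mp (.ax (.box04 b)) hb)
          refine (World.all_holds hv _ _).2 fun y => (y.isTheory.isVal.imp _ _).2 fun hy => ?_
          exact h ⟨(y, true)⟩ fun _ => hy
        · exact x.down.1.isTheory.box0_of_all
            ((World.all_holds hv _ a).2 fun y => h ⟨(y, true)⟩ fun hb' => absurd hb' hb)
    · exact fun h => ⟨_, ⟨.supports a, rfl⟩, fun y hy => y.down.1.box0_elim (hy h)⟩

end Canonical

/-- Completeness of the static logic. -/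
theorem thm_of_valid {a : StaticForm}
    (h : ∀ (W : Type u) (M : Model W), M.IsCap → ∀ w, a.Sat M w) : Thm a := by
  refine .of_isVal fun v hv hT => ?_
  have hth : IsTheory v := ⟨hv, hT⟩
  exact (truth_lemma hth a ⟨(⟨v, hth, fun _ => Iff.rfl⟩, true)⟩).1
    (h _ _ (canonicalModel_isCap hth) _)

end StaticForm

/-! ### Reduction to the static language -/

section Reducible

variable {F ι : Type} [StaticOps F]

/-- The formula `a` is provably equivalent to a static one. -/
def Reducible (D : ι → F → F) (Red : F → Prop) (a : F) : Prop :=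
  ∃ s : StaticForm, Theorem D Red (equ a s.embed)

namespace Reducible

variable {D : ι → F → F} {Red : F → Prop}

theorem of_red {a b : F} (h : Red (equ a b)) (hb : Reducible D Red b) : Reducible D Red a :=
  ⟨hb.choose, .equ_trans (.red h) hb.choose_spec⟩

theorem embed (s : StaticForm) : Reducible D Red s.embed :=
  ⟨s, .of_isVal fun _ hv _ => (hv.equ _ _).2 Iff.rfl⟩

theorem atom (p : ℕ) : Reducible D Red (StaticOps.atom p) := embed (.atom p)

theorem neg {a : F} (h : Reducible D Red a) : Reducible D Red (StaticOps.neg a) :=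
  ⟨.neg h.choose, h.choose_spec.neg_congr⟩

theorem conj {a b : F} (ha : Reducible D Red a) (hb : Reducible D Red b) :
    Reducible D Red (StaticOps.conj a b) :=
  ⟨.conj ha.choose hb.choose, ha.choose_spec.conj_congr hb.choose_spec⟩

theorem box0 {a : F} (h : Reducible D Red a) : Reducible D Red (StaticOps.box0 a) :=
  ⟨.box0 h.choose, Theorem.congr_of_mono .monBox0 h.choose_spec⟩

theorem box {a : F} (h : Reducible D Red a) : Reducible D Red (StaticOps.box a) :=
  ⟨.box h.choose, Theorem.congr_of_mono Theorem.box_mono h.choose_spec⟩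

theorem all {a : F} (h : Reducible D Red a) : Reducible D Red (StaticOps.all a) :=
  ⟨.all h.choose, Theorem.congr_of_mono Theorem.all_mono h.choose_spec⟩

theorem bot : Reducible D Red bot := (atom 0).conj (atom 0).neg

theorem top : Reducible D Red top := bot.neg

theorem imp {a b : F} (ha : Reducible D Red a) (hb : Reducible D Red b) :
    Reducible D Red (imp a b) := (ha.conj hb.neg).neg

theorem disj {a b : F} (ha : Reducible D Red a) (hb : Reducible D Red b) :
    Reducible D Red (disj a b) := (ha.neg.conj hb.neg).neg

theorem ex {a : F} (h : Reducible D Red a) : Reducible D Red (ex a) := h.neg.all.neg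

theorem bigConj {l : List F} (h : ∀ a ∈ l, Reducible D Red a) : Reducible D Red (bigConj l) := by
  induction l with
  | nil => exact top
  | cons a l ih =>
    exact (h a List.mem_cons_self).conj (ih fun b hb => h b (List.mem_cons_of_mem _ hb))

theorem bigDisj {l : List F} (h : ∀ a ∈ l, Reducible D Red a) : Reducible D Red (bigDisj l) := by
  induction l with
  | nil => exact bot
  | cons a l ih =>
    exact (h a List.mem_cons_self).disj (ih fun b hb => h b (List.mem_cons_of_mem _ hb))

/-- A dynamic modality that can be pushed through the static connectives can be eliminated. -/
theorem dyn (i : ι) (hatom : ∀ p, Reducible D Red (D i (StaticOps.atom p)))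
    (hneg : ∀ a, Reducible D Red (D i a) → Reducible D Red (D i (StaticOps.neg a)))
    (hconj : ∀ a b, Reducible D Red (D i a) → Reducible D Red (D i b) →
      Reducible D Red (D i (StaticOps.conj a b)))
    (hbox0 : ∀ a, Reducible D Red (D i a) → Reducible D Red (D i (StaticOps.box0 a)))
    (hbox : ∀ a, Reducible D Red (D i a) → Reducible D Red (D i (StaticOps.box a)))
    (hall : ∀ a, Reducible D Red (D i a) → Reducible D Red (D i (StaticOps.all a)))
    {a : F} (ha : Reducible D Red a) : Reducible D Red (D i a) := by
  obtain ⟨s, hs⟩ := ha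
  have h : Reducible D Red (D i s.embed) := by
    clear hs
    induction s with
    | atom p => exact hatom p
    | neg a ih => exact hneg _ ih
    | conj a b iha ihb => exact hconj _ _ iha ihb
    | box0 a ih => exact hbox0 _ ih
    | box a ih => exact hbox _ ih
    | all a ih => exact hall _ ih
  exact ⟨h.choose, .equ_trans (.replace i hs) h.choose_spec⟩

/-- Completeness for a formula that reduces to the static language, given soundness. -/
theorem theorem_of_valid {sat : F → ∀ {W : Type u}, Model W → W → Prop}
    (hs : ∀ {W : Type u} (M : Model W), IsStaticSat M fun a => sat a M)
    (hsound : ∀ a, Theorem D Red a →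
      ∀ {W : Type u} (M : Model W), M.IsPreorders → ∀ w, sat a M w)
    {a : F} (ha : Reducible D Red a)
    (hvalid : ∀ (W : Type u) (M : Model W), M.IsCap → ∀ w, sat a M w) : Theorem D Red a := by
  obtain ⟨s, h⟩ := ha
  refine .mp_equ h (StaticForm.Thm.embed (StaticForm.thm_of_valid.{u} fun W M hM w => ?_))
  exact (StaticForm.sat_embed (hs M) s w).1
    (((hs M).equ _ _ w).1 (hsound _ h M hM.isPreorders w) |>.1 (hvalid W M hM w))

end Reducible

end Reducible

/-! ### Public announcements -/

namespace AnnForm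

theorem isStaticSat {W : Type u} (M : Model W) : IsStaticSat M fun a : AnnForm => a.Sat M :=
  ⟨fun _ _ => Iff.rfl, fun _ _ => Iff.rfl, fun _ _ _ => Iff.rfl, fun _ _ => Iff.rfl,
    fun _ _ => Iff.rfl, fun _ _ => Iff.rfl⟩

end AnnForm

theorem Model.IsPreorders.update {W : Type u} {M : Model W} (hM : M.IsPreorders) (P : Set W) :
    (M.update P).IsPreorders where
  pre := by
    rintro _ ⟨R, hR, rfl⟩
    exact ⟨fun x => (hM.pre R hR).1 x, fun x y z => (hM.pre R hR).2 x y z⟩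
  ev_nonempty := hM.ev_nonempty.elim fun R hR => ⟨_, R, hR, rfl⟩

theorem AnnReduction.sound {a : AnnForm} (h : AnnReduction a) {W : Type u} (M : Model W)
    (w : W) : a.Sat M w := by
  have hs := AnnForm.isStaticSat M
  cases h with
  | pa1 a p =>
    exact (hs.equ _ _ w).2 (hs.imp a (.atom p) w).symm
  | pa2 a b =>
    refine (hs.equ _ _ w).2 (Iff.trans ?_ (hs.imp _ _ w).symm)
    exact ⟨fun h ha h' => h ha (h' ha), fun h ha h' => h ha fun _ => h'⟩
  | pa3 a b c =>
    exact (hs.equ _ _ w).2 ⟨fun h => ⟨fun ha => (h ha).1, fun ha => (h ha).2⟩,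
      fun h ha => ⟨h.1 ha, h.2 ha⟩⟩
  | pa4 a b =>
    refine (hs.equ _ _ w).2 (Iff.trans ?_ (hs.imp _ _ w).symm)
    refine forall_congr' fun ha => ⟨?_, ?_⟩
    · rintro ⟨_, ⟨R, hR, rfl⟩, h⟩
      exact ⟨R, hR, fun v hv => (hs.imp _ _ v).2 fun _ hav => h ⟨v, hav⟩ hv⟩
    · rintro ⟨R, hR, h⟩
      exact ⟨_, ⟨R, hR, rfl⟩, fun v hv => (hs.imp _ _ v.1).1 (h v.1 hv) v.2 v.2⟩
  | pa5 a b =>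
    refine (hs.equ _ _ w).2 (Iff.trans ?_ (hs.imp _ _ w).symm)
    refine forall_congr' fun ha => ⟨fun h v hv => ?_, fun h v hv => ?_⟩
    · refine (hs.imp _ _ v).2 fun _ hav => h ⟨v, hav⟩ ?_
      rintro _ ⟨R, hR, rfl⟩
      exact hv R hR
    · exact (hs.imp _ _ v.1).1 (h v.1 fun R hR => hv _ ⟨R, hR, rfl⟩) v.2 v.2
  | pa6 a b =>
    refine (hs.equ _ _ w).2 (Iff.trans ?_ (hs.imp _ _ w).symm)
    exact forall_congr' fun ha => ⟨fun h v hav => h ⟨v, hav⟩, fun h v => h v.1 v.2⟩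

theorem AnnTheorem.sound {a : AnnForm} (h : AnnTheorem a) {W : Type u} (M : Model W)
    (hM : M.IsPreorders) (w : W) : a.Sat M w :=
  Theorem.sound (D := AnnForm.ann) (sat := AnnForm.Sat) AnnForm.isStaticSat
    (fun _ h _ M _ w => h.sound M w)
    (fun _ _ _ h _ _ hM _ => forall_congr' fun _ => h _ (hM.update _) _) h M hM w

theorem AnnForm.reducible (a : AnnForm) : Reducible AnnForm.ann AnnReduction a := by
  induction a with
  | atom p => exact .atom p
  | neg a ih => exact ih.neg
  | conj a b iha ihb => exact iha.conj ihb
  | box0 a ih => exact ih.box0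
  | box a ih => exact ih.box
  | all a ih => exact ih.all
  | ann a b iha ihb =>
    exact .dyn a (fun p => .of_red (.pa1 a p) (iha.imp (.atom p)))
      (fun b h => .of_red (.pa2 a b) (iha.imp h.neg))
      (fun b c hb hc => .of_red (.pa3 a b c) (hb.conj hc))
      (fun b h => .of_red (.pa4 a b) (iha.imp (iha.imp h).box0))
      (fun b h => .of_red (.pa5 a b) (iha.imp (iha.imp h).box))
      (fun b h => .of_red (.pa6 a b) (iha.imp h.all)) ihb

theorem annTheorem_iff_valid (a : AnnForm) : AnnTheorem a ↔ AnnForm.Valid.{u} a :=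
  ⟨fun h _ M hM w => h.sound M hM.isPreorders w,
    a.reducible.theorem_of_valid (sat := AnnForm.Sat) AnnForm.isStaticSat
      fun _ h _ M hM w => AnnTheorem.sound h M hM w⟩

/-! ### Normal forms of programs -/

theorem Form.isStaticSat {k : Action} {W : Type u} (M : Model W) :
    IsStaticSat M fun a : Form k => a.Sat M :=
  ⟨fun _ _ => Iff.rfl, fun _ _ => Iff.rfl, fun _ _ _ => Iff.rfl, fun _ _ => Iff.rfl,
    fun _ _ => Iff.rfl, fun _ _ => Iff.rfl⟩

theorem mem_seqsOfLength {n m : ℕ} {l : List (Fin n)} : l ∈ seqsOfLength n m ↔ l.length = m := by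
  induction m generalizing l with
  | zero => simp [seqsOfLength]
  | succ m ih =>
    cases l with
    | nil => simp [seqsOfLength]
    | cons i l => simp [seqsOfLength, ih]

theorem mem_S0 {n : ℕ} {s : Fin n × List (Fin n)} : s ∈ S0 n ↔ s.2.length < n := by
  obtain ⟨i, l⟩ := s
  simp only [S0, List.mem_flatMap, List.mem_map, List.mem_finRange, List.mem_range, true_and,
    mem_seqsOfLength, Prod.mk.injEq]
  constructor
  · rintro ⟨_, m, hm, l, rfl, rfl, rfl⟩
    exact hm
  · exact fun h => ⟨i, _, h, l, rfl, rfl, rfl⟩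

/-- Points that are joined by a path are joined by one without repetitions. -/
theorem exists_nodup_path {α : Type*} {L : α → α → Prop} {i j : α}
    (h : Relation.ReflTransGen L i j) :
    ∃ l : List α, (i :: l).IsChain L ∧ (i :: l).Nodup ∧
      (i :: l).getLast (List.cons_ne_nil _ _) = j := by
  induction h using Relation.ReflTransGen.head_induction_on with
  | refl => exact ⟨[], by simp⟩
  | @head a b hab _ ih =>
    obtain ⟨l, hc, hn, hl⟩ := ih
    by_cases ha : a ∈ b :: l
    · obtain ⟨l₁, l₂, heq⟩ := List.append_of_mem ha
      refine ⟨l₂, ?_, ?_, ?_⟩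
      · rw [heq] at hc
        exact hc.right_of_append
      · rw [heq] at hn
        exact hn.of_append_right
      · rw [← hl]
        simp [heq]
    · exact ⟨b :: l, List.isChain_cons_cons.2 ⟨hab, hc⟩, List.nodup_cons.2 ⟨ha, hn⟩, by simpa⟩

theorem reflTransGen_getLast {α : Type*} {L : α → α → Prop} {i : α} {l : List α}
    (h : (i :: l).IsChain L) :
    Relation.ReflTransGen L i ((i :: l).getLast (List.cons_ne_nil _ _)) := by
  induction l generalizing i with
  | nil => exact .refl
  | cons j l ih =>
    rw [List.isChain_cons_cons] at h
    rw [List.getLast_cons_cons]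
    exact .head h.1 (ih h.2)

section Connected

variable {k : Action} (d : List (Form k × Form k)) {W : Type u} (M : Model W)

/-- `i` is linked to `j` if `∃(ψ_i ∧ φ_j)` holds. -/
def Linked (i j : Fin d.length) : Prop := ∃ u, (psi d i).Sat M u ∧ (phi d j).Sat M u

/-- `x` is connected to `y` by non-trivial steps of `⋃_i (?φ_i; A; ?ψ_i)`: there is a path of
links from some `i` with `φ_i` at `x` to some `j` with `ψ_j` at `y`. -/
def Connected (x y : W) : Prop :=
  ∃ i j, (phi d i).Sat M x ∧ Relation.ReflTransGen (Linked d M) i j ∧ (psi d j).Sat M y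

variable {d M}

theorem sat_seqForm (s : Fin d.length × List (Fin d.length)) (x : W) :
    (seqForm d s).Sat M x ↔ (phi d s.1).Sat M x ∧ (s.1 :: s.2).IsChain (Linked d M) := by
  obtain ⟨i, l⟩ := s
  have hs := Form.isStaticSat (k := k) M
  refine (hs.conj _ _ x).trans (and_congr Iff.rfl ?_)
  induction l generalizing i with
  | nil => simpa [links, bigConj] using (hs.top x)
  | cons j l ih =>
    refine (hs.conj _ _ x).trans ?_
    rw [List.isChain_cons_cons]
    exact and_congr ((hs.ex _ x).trans (exists_congr fun u => hs.conj _ _ u)) (ih j)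

/-- The sequences of `S₀` suffice, because a path of links without repetitions has at most `|I|`
members. -/
theorem exists_S0_iff_connected (x y : W) :
    (∃ s ∈ S0 d.length, (seqForm d s).Sat M x ∧ (seqEnd d s).Sat M y) ↔ Connected d M x y := by
  constructor
  · rintro ⟨s, -, hx, hy⟩
    rw [sat_seqForm] at hx
    exact ⟨_, _, hx.1, reflTransGen_getLast hx.2, hy⟩
  · rintro ⟨i, j, hi, hij, hj⟩
    obtain ⟨l, hc, hn, rfl⟩ := exists_nodup_path hij
    refine ⟨(i, l), mem_S0.2 ?_, (sat_seqForm _ _).2 ⟨hi, hc⟩, hj⟩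
    simpa using hn.length_le_card

theorem starNormalForm_rel (x y : W) :
    (starNormalForm d).Rel M x y ↔ x = y ∨ Connected d M x y := by
  rw [← exists_S0_iff_connected, starNormalForm]
  induction S0 d.length with
  | nil =>
    simp only [List.map_nil, List.foldr_nil, Prog.Rel, List.not_mem_nil, false_and, exists_false,
      or_false]
    exact and_iff_left (((Form.isStaticSat M).top x).2 trivial)
  | cons s l ih =>
    simp only [List.map_cons, List.foldr_cons, Prog.Rel, ih, List.exists_mem_cons_iff]
    rw [or_left_comm]
    refine or_congr_right (or_congr_left ?_)
    constructor
    · rintro ⟨_, ⟨rfl, hx⟩, _, -, rfl, hy⟩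
      exact ⟨hx, hy⟩
    · exact fun ⟨hx, hy⟩ => ⟨x, ⟨rfl, hx⟩, y, trivial, rfl, hy⟩

/-- The closure of `⋃_i (?φ_i; A; ?ψ_i) ∪ (?θ)` is reflexivity together with connectedness. -/
theorem reflTransGen_iff_connected {T : W → W → Prop} {θ : W → Prop}
    (hT : ∀ x y, T x y ↔ (∃ p ∈ d, p.1.Sat M x ∧ p.2.Sat M y) ∨ (x = y ∧ θ x)) (x y : W) :
    Relation.ReflTransGen T x y ↔ x = y ∨ Connected d M x y := by
  have step : ∀ x y i, (phi d i).Sat M x → (psi d i).Sat M y → T x y := fun x y i hx hy =>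
    (hT x y).2 (.inl ⟨d.get i, d.get_mem i, hx, hy⟩)
  constructor
  · intro h
    induction h using Relation.ReflTransGen.head_induction_on with
    | refl => exact .inl rfl
    | @head x z hxz _ ih =>
      rcases (hT x z).1 hxz with ⟨p, hp, hx, hz⟩ | ⟨rfl, -⟩
      · obtain ⟨i, rfl⟩ := List.get_of_mem hp
        rcases ih with rfl | ⟨j, m, hj, hjm, hm⟩
        · exact .inr ⟨i, i, hx, .refl, hz⟩
        · exact .inr ⟨i, m, hx, .head ⟨z, hz, hj⟩ hjm, hm⟩
      · exact ih
  · rintro (rfl | ⟨i, j, hi, hij, hj⟩)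
    · exact .refl
    · induction hij using Relation.ReflTransGen.head_induction_on generalizing x with
      | refl => exact .single (step x y j hi hj)
      | @head i m him _ ih =>
        obtain ⟨u, hu, hu'⟩ := him
        exact .head (step x u i hi hu) (ih u hu')

end Connected

theorem Prog.rel_iff_normalForm {k : Action} {W : Type u} (M : Model W) :
    ∀ (r : Prog k) (x y : W), r.Rel M x y ↔
      (∃ p ∈ r.normalForm.1, p.1.Sat M x ∧ p.2.Sat M y) ∨ (x = y ∧ r.normalForm.2.Sat M x)
  | .univ, x, y => by
    have hs := Form.isStaticSat (k := k) M
    simp [Prog.normalForm, Prog.Rel, hs.top]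
  | .test a, x, y => by
    have hs := Form.isStaticSat (k := k) M
    simp [Prog.normalForm, Prog.Rel, hs.bot]
  | .union r s, x, y => by
    have hs := Form.isStaticSat (k := k) M
    simp only [Prog.normalForm, Prog.Rel, hs.disj, r.rel_iff_normalForm M, s.rel_iff_normalForm M,
      List.mem_append, or_and_right, exists_or, and_or_left]
    exact or_or_or_comm
  | .seq r s, x, y => by
    have hs := Form.isStaticSat (k := k) M
    simp only [Prog.normalForm, Prog.Rel, r.rel_iff_normalForm M, s.rel_iff_normalForm M,
      List.mem_append, List.mem_flatMap, List.mem_map, hs.conj]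
    constructor
    · rintro ⟨z, ⟨p, hp, hx, hz⟩ | ⟨rfl, hz⟩, ⟨q, hq, hz', hy⟩ | ⟨rfl, hz'⟩⟩
      · refine .inl ⟨_, .inl (.inl ⟨p, hp, q, hq, rfl⟩), (hs.conj _ _ x).2 ⟨hx, ?_⟩, hy⟩
        exact (hs.ex _ x).2 ⟨z, hz, hz'⟩
      · exact .inl ⟨_, .inl (.inr ⟨p, hp, rfl⟩), hx, hz, hz'⟩
      · exact .inl ⟨_, .inr ⟨q, hq, rfl⟩, ⟨hz, hz'⟩, hy⟩
      · exact .inr ⟨rfl, hz, hz'⟩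
    · rintro (⟨_, (⟨p, hp, q, hq, rfl⟩ | ⟨p, hp, rfl⟩) | ⟨q, hq, rfl⟩, hx, hy⟩ | ⟨rfl, hz, hz'⟩)
      · obtain ⟨z, hz, hz'⟩ := (hs.ex _ x).1 hx.2
        exact ⟨z, .inl ⟨p, hp, hx.1, hz⟩, .inl ⟨q, hq, hz', hy⟩⟩
      · exact ⟨y, .inl ⟨p, hp, hx, hy.1⟩, .inr ⟨rfl, hy.2⟩⟩
      · exact ⟨x, .inr ⟨rfl, hx.1⟩, .inl ⟨q, hq, hx.2, hy⟩⟩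
      · exact ⟨x, .inr ⟨rfl, hz⟩, .inr ⟨rfl, hz'⟩⟩
  | .star r, x, y => by
    have hs := Form.isStaticSat (k := k) M
    simp only [Prog.normalForm, Prog.Rel, hs.top, and_true,
      reflTransGen_iff_connected (r.rel_iff_normalForm M), ← exists_S0_iff_connected,
      List.mem_map]
    rw [or_comm]
    refine or_congr_left ⟨?_, ?_⟩
    · exact fun ⟨s, h, h'⟩ => ⟨_, ⟨s, h, rfl⟩, h'⟩
    · rintro ⟨_, ⟨s, h, rfl⟩, h'⟩
      exact ⟨s, h, h'⟩

theorem anyNF_of_computedNF {k : Action} {r : Prog k} {d : List (Form k × Form k)}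
    (h : ComputedNF r d) : AnyNF.{u} r d := by
  subst h
  intro W M _ x y
  rw [starNormalForm_rel]
  exact reflTransGen_iff_connected (r.rel_iff_normalForm M) x y

/-! ### Superfluous evidence -/

/-- `N` arises from `M` by adding pieces of evidence each of which contains one of `M`. -/
structure Model.Weakens {W : Type u} (M N : Model W) : Prop where
  val_eq : M.val = N.val
  subset : M.ev ⊆ N.ev
  exists_le : ∀ R' ∈ N.ev, ∃ R ∈ M.ev, R ≤ R'

namespace Model.Weakens

variable {W : Type u} {M N : Model W}

theorem agg_eq (h : M.Weakens N) : M.agg = N.agg := by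
  funext x y
  refine propext ⟨fun hxy R' hR' => ?_, fun hxy R hR => hxy R (h.subset hR)⟩
  obtain ⟨R, hR, hle⟩ := h.exists_le R' hR'
  exact hle x y (hxy R hR)

theorem act (h : M.Weakens N) (k : Action) (R : W → W → Prop) :
    (M.act k R).Weakens (N.act k R) := by
  cases k with
  | add =>
    refine ⟨h.val_eq, Set.union_subset_union_left _ h.subset, ?_⟩
    rintro R' (hR' | hR')
    · obtain ⟨S, hS, hle⟩ := h.exists_le R' hR'
      exact ⟨S, .inl hS, hle⟩
    · exact ⟨R', .inr hR', le_rfl⟩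
  | upgrade =>
    refine ⟨h.val_eq, ?_, ?_⟩
    · rintro _ ⟨S, hS, rfl⟩
      exact ⟨S, h.subset hS, rfl⟩
    · rintro _ ⟨S', hS', rfl⟩
      obtain ⟨S, hS, hle⟩ := h.exists_le S' hS'
      exact ⟨_, ⟨S, hS, rfl⟩, fun x y hxy => hxy.imp_right fun hxy => ⟨hxy.1, hle x y hxy.2⟩⟩

end Model.Weakens

mutual
/-- Superfluous evidence does not affect satisfaction. -/
theorem Form.sat_iff_of_weakens {k : Action} : ∀ (a : Form k) {W : Type u} {M N : Model W},
    M.Weakens N → ∀ w, a.Sat M w ↔ a.Sat N w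
  | .atom p, _, M, N, h, w => by simp only [Form.Sat, h.val_eq]
  | .neg a, _, M, N, h, w => by simp only [Form.Sat, a.sat_iff_of_weakens h]
  | .conj a b, _, M, N, h, w => by
    simp only [Form.Sat, a.sat_iff_of_weakens h, b.sat_iff_of_weakens h]
  | .box0 a, _, M, N, h, w => by
    simp only [Form.Sat, a.sat_iff_of_weakens h]
    constructor
    · exact fun ⟨R, hR, hv⟩ => ⟨R, h.subset hR, hv⟩
    · rintro ⟨R', hR', hv⟩
      obtain ⟨R, hR, hle⟩ := h.exists_le R' hR'
      exact ⟨R, hR, fun v hwv => hv v (hle w v hwv)⟩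
  | .box a, _, M, N, h, w => by simp only [Form.Sat, a.sat_iff_of_weakens h, h.agg_eq]
  | .all a, _, M, N, h, w => by simp only [Form.Sat, a.sat_iff_of_weakens h]
  | .dyn r a, _, M, N, h, w => by
    have hr : r.Rel M = r.Rel N := funext fun x => funext fun y =>
      propext (r.rel_iff_of_weakens h x y)
    simp only [Form.Sat, hr]
    exact a.sat_iff_of_weakens (h.act k _) w
theorem Prog.rel_iff_of_weakens {k : Action} : ∀ (r : Prog k) {W : Type u} {M N : Model W},
    M.Weakens N → ∀ x y, r.Rel M x y ↔ r.Rel N x y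
  | .univ, _, M, N, h, x, y => by simp only [Prog.Rel]
  | .test a, _, M, N, h, x, y => by simp only [Prog.Rel, a.sat_iff_of_weakens h]
  | .union r s, _, M, N, h, x, y => by
    simp only [Prog.Rel, r.rel_iff_of_weakens h, s.rel_iff_of_weakens h]
  | .seq r s, _, M, N, h, x, y => by
    simp only [Prog.Rel, r.rel_iff_of_weakens h, s.rel_iff_of_weakens h]
  | .star r, _, M, N, h, x, y => by
    have hr : r.Rel M = r.Rel N := funext fun x => funext fun y =>
      propext (r.rel_iff_of_weakens h x y)
    simp only [Prog.Rel, hr]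
end

/-- `d` gives a normal form for `r*` on all models whose evidence is a non-empty family of
preorders. -/
def IsNF {k : Action} (r : Prog k) (d : List (Form k × Form k)) : Prop :=
  ∀ {W : Type u} (M : Model W), M.IsPreorders → ∀ x y,
    Relation.ReflTransGen (r.Rel M) x y ↔ x = y ∨ Connected d M x y

/-- A model becomes an intersection model when the trivial evidence, which is superfluous, is
added. -/
theorem isNF_of_anyNF {k : Action} {r : Prog k} {d : List (Form k × Form k)}
    (h : AnyNF.{u} r d) : IsNF.{u} r d := by
  intro W M hM x y
  obtain ⟨R, hR⟩ := hM.ev_nonempty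
  let N : Model W := ⟨M.ev ∪ {fun _ _ => True}, M.val⟩
  have hMN : M.Weakens N := by
    refine ⟨rfl, Set.subset_union_left, ?_⟩
    rintro R' (hR' | rfl)
    · exact ⟨R', hR', le_rfl⟩
    · exact ⟨R, hR, fun _ _ _ => trivial⟩
  have hN : N.IsCap := by
    refine ⟨⟨x⟩, ?_, .inr rfl⟩
    rintro R' (hR' | rfl)
    · exact hM.pre R' hR'
    · exact ⟨fun _ => trivial, fun _ _ _ _ _ => trivial⟩
  rw [← starNormalForm_rel, (starNormalForm d).rel_iff_of_weakens hMN, ← h W N hN,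
    ← (Prog.star r).rel_iff_of_weakens hMN]
  rfl

/-! ### Soundness of the reduction axioms for addition and upgrade -/

theorem isPre_reflTransGen {W : Type u} (T : W → W → Prop) : IsPre (Relation.ReflTransGen T) :=
  ⟨fun _ => .refl, fun _ _ _ => .trans⟩

theorem Model.IsPreorders.act {W : Type u} {M : Model W} (hM : M.IsPreorders) (k : Action)
    {R : W → W → Prop} (hR : IsPre R) : (M.act k R).IsPreorders := by
  cases k with
  | add =>
    refine ⟨?_, hM.ev_nonempty.mono Set.subset_union_left⟩
    rintro S (hS | rfl)
    · exact hM.pre S hS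
    · exact hR
  | upgrade =>
    refine ⟨?_, hM.ev_nonempty.elim fun S hS => ⟨_, S, hS, rfl⟩⟩
    rintro _ ⟨S, hS, rfl⟩
    obtain ⟨hr, ht⟩ := hM.pre S hS
    refine ⟨fun x => .inr ⟨hR.1 x, hr x⟩, fun x y z hxy hyz => ?_⟩
    rcases hxy with ⟨hxy, hyx⟩ | ⟨hxy, hxy'⟩
    · have hyz' : R y z := hyz.elim And.left And.left
      exact .inl ⟨hR.2 _ _ _ hxy hyz', fun hzx => hyx (hR.2 _ _ _ hyz' hzx)⟩
    · rcases hyz with ⟨hyz, hzy⟩ | ⟨hyz, hyz'⟩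
      · exact .inl ⟨hR.2 _ _ _ hxy hyz, fun hzx => hzy (hR.2 _ _ _ hzx hxy)⟩
      · exact .inr ⟨hR.2 _ _ _ hxy hyz, ht _ _ _ hxy' hyz'⟩

section Sat

variable {k : Action} {W : Type u} {M : Model W} {d : List (Form k × Form k)}

/-- The shape in which the reduction axioms speak about the points that `w` is connected to;
`f` is `∀` or `□`, and `T` is the set of points over which it quantifies at `w`. -/
theorem sat_bigConj_S0 {f : Form k → Form k} {T : W → Prop} {w : W}
    (hf : ∀ a, (f a).Sat M w ↔ ∀ v, T v → a.Sat M v)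
    (g : Fin d.length × List (Fin d.length) → Form k) {e : W → Prop}
    (hg : ∀ s v, (g s).Sat M v ↔ ((seqEnd d s).Sat M v → e v)) :
    (bigConj ((S0 d.length).map fun s => imp (seqForm d s) (f (g s)))).Sat M w ↔
      ∀ v, T v → Connected d M w v → e v := by
  have hs := Form.isStaticSat (k := k) M
  simp only [hs.bigConj, List.forall_mem_map, hs.imp, hf, hg, ← exists_S0_iff_connected]
  exact ⟨fun h v hv ⟨s, hs, hw, hsv⟩ => h s hs hw v hv hsv,
    fun h s hs hw v hv hsv => h v hv ⟨s, hs, hw, hsv⟩⟩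

theorem sat_exactly {n : ℕ} (f : Fin n → Form k) (J : List (Fin n)) (w : W) :
    (exactly f J).Sat M w ↔ ∀ i, i ∈ J ↔ (f i).Sat M w := by
  have hs := Form.isStaticSat (k := k) M
  refine (hs.conj _ _ w).trans ?_
  simp only [hs.bigConj, List.forall_mem_map, List.mem_filter, List.mem_finRange, true_and,
    decide_eq_true_eq, hs.neg]
  exact ⟨fun h i => ⟨h.1 i, fun hi => by_contra fun hJ => h.2 i hJ hi⟩,
    fun h => ⟨fun i => (h i).1, fun i hJ hi => hJ ((h i).2 hi)⟩⟩

/-- A disjunction over the subsets `J` of `I` that are described exactly is a statement about one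
of them. -/
theorem sat_bigDisj_exactly {n : ℕ} (f : Fin n → Form k) (g : List (Fin n) → Form k) (w : W)
    {P : Prop} (hP : ∀ J : List (Fin n), (∀ i, i ∈ J ↔ (f i).Sat M w) → ((g J).Sat M w ↔ P)) :
    (bigDisj ((subsets n).map fun J => conj (exactly f J) (g J))).Sat M w ↔ P := by
  classical
  have hs := Form.isStaticSat (k := k) M
  simp only [hs.bigDisj, List.mem_map, exists_exists_and_eq_and, hs.conj, sat_exactly]
  constructor
  · exact fun ⟨J, _, hJ, h⟩ => (hP J hJ).1 h
  · intro h
    have hJ : ∀ i, i ∈ (List.finRange n).filter (fun i => (f i).Sat M w) ↔ (f i).Sat M w := by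
      simp
    exact ⟨_, List.mem_sublists.2 List.filter_sublist, hJ, (hP _ hJ).2 h⟩

/-- Two points that are connected in one direction are connected in the other one, or equal, if
and only if there is a path back with at least two members: if there is any path back, another
round through both points lengthens it. -/
theorem Connected.back_iff {w v : W} (h : Connected d M w v) :
    (v = w ∨ Connected d M v w) ↔
      ∃ j u, Connected d M v u ∧ (phi d j).Sat M u ∧ (psi d j).Sat M w := by
  obtain ⟨i, j, hi, hij, hj⟩ := h
  have key : ∀ i' m, (phi d i').Sat M v → Relation.TransGen (Linked d M) i' m →
      (psi d m).Sat M w → ∃ j u, Connected d M v u ∧ (phi d j).Sat M u ∧ (psi d j).Sat M w := by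
    intro i' m hi' him hm
    obtain ⟨b, hib, u, hu, hu'⟩ := Relation.TransGen.tail'_iff.1 him
    exact ⟨m, u, ⟨i', b, hi', hib, hu⟩, hu', hm⟩
  constructor
  · rintro (rfl | ⟨i', m, hi', him, hm⟩)
    · exact key i j hi ((Relation.TransGen.tail' hij ⟨v, hj, hi⟩).trans_left hij) hj
    · exact key i' m hi' ((Relation.TransGen.tail' him ⟨w, hm, hi⟩).trans_left
        (hij.trans (.head ⟨v, hj, hi'⟩ him))) hm
  · rintro ⟨m, u, ⟨i', j', hi', hij', hj'⟩, hu, hw⟩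
    exact .inr ⟨i', m, hi', hij'.tail ⟨u, hj', hu⟩, hw⟩

end Sat

theorem AddReduction.sound {N : Prog .add → List (Form .add × Form .add) → Prop}
    (hN : ∀ r d, N r d → IsNF.{u} r d) {a : Form .add} (h : AddReduction N a) {W : Type u}
    (M : Model W) (hM : M.IsPreorders) (w : W) : a.Sat M w := by
  have hs := Form.isStaticSat (k := .add) M
  cases h with
  | ea1 r p => exact (hs.equ _ _ w).2 Iff.rfl
  | ea2 r c => exact (hs.equ _ _ w).2 Iff.rfl
  | ea3 r c c' => exact (hs.equ _ _ w).2 Iff.rfl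
  | ea6 r c => exact (hs.equ _ _ w).2 Iff.rfl
  | ea4 r d c hd =>
    refine (hs.equ _ _ w).2 (Iff.trans ?_ (hs.disj _ _ w).symm)
    refine Iff.trans ?_ (or_congr_right (and_congr_right fun _ =>
      (sat_bigConj_S0 (f := Form.all) (T := fun _ => True)
        (fun a => by simp only [Form.Sat, true_imp_iff]) _ fun s v => hs.imp _ _ v).symm))
    constructor
    · rintro ⟨R, hR | rfl, h⟩
      · exact .inl ⟨R, hR, h⟩
      · exact .inr ⟨h w .refl, fun v _ hv => h v ((hN r d hd M hM w v).2 (.inr hv))⟩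
    · rintro (⟨R, hR, h⟩ | ⟨hw, h⟩)
      · exact ⟨R, .inl hR, h⟩
      · refine ⟨_, .inr rfl, fun v hv => ?_⟩
        rcases (hN r d hd M hM w v).1 hv with rfl | hv
        · exact hw
        · exact h v trivial hv
  | ea5 r d c hd =>
    refine (hs.equ _ _ w).2 (Iff.trans ?_ (and_congr_right fun _ =>
      (sat_bigConj_S0 (f := Form.box) (T := M.agg w)
        (fun a => Iff.rfl) _ fun s v => hs.imp _ _ v).symm))
    constructor
    · intro h
      have h' : ∀ v, M.agg w v → Relation.ReflTransGen (r.Rel M) w v →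
          c.Sat (M.act .add (Relation.ReflTransGen (r.Rel M))) v := by
        refine fun v hv hv' => h v ?_
        rintro R (hR | rfl)
        · exact hv R hR
        · exact hv'
      exact ⟨h' w (fun R hR => (hM.pre R hR).1 w) .refl,
        fun v hv hv' => h' v hv ((hN r d hd M hM w v).2 (.inr hv'))⟩
    · rintro ⟨hw, h⟩ v hv
      rcases (hN r d hd M hM w v).1 (hv _ (.inr rfl)) with rfl | hv'
      · exact hw
      · exact h v (fun R hR => hv R (.inl hR)) hv'

section Upgrade

variable {W : Type u} {M : Model W} {d : List (Form .upgrade × Form .upgrade)} {e : Form .upgrade}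

/-- `π^<(χ)` says that `χ` holds at all strict successors. -/
theorem sat_piLt (w : W) :
    (piLt d e).Sat M w ↔
      ∀ v, Connected d M w v → ¬ (v = w ∨ Connected d M v w) → e.Sat M v := by
  have hs := Form.isStaticSat (k := .upgrade) M
  refine sat_bigDisj_exactly _ _ w fun J hJ => ?_
  have hall : ∀ (a : Form .upgrade) (w : W),
      (Form.all a).Sat M w ↔ ∀ v, True → a.Sat M v := fun a w => by
    simp only [Form.Sat, true_imp_iff]
  refine (sat_bigConj_S0 (f := Form.all) (T := fun _ => True) (fun a => hall a w) _
    (e := fun v => (∀ u, True → Connected d M v u → ∀ j ∈ J, ¬ (phi d j).Sat M u) → e.Sat M v)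
    fun s v => ?_).trans ?_
  · refine (hs.imp _ _ v).trans ?_
    rw [← and_imp]
    refine imp_congr_left ((hs.conj _ _ v).trans (and_congr_right fun _ => ?_))
    refine sat_bigConj_S0 (f := Form.all) (T := fun _ => True) (fun a => hall a v) _ fun s u => ?_
    refine (hs.imp _ _ u).trans (imp_congr_right fun _ => ?_)
    rw [hs.bigConj, List.forall_mem_map]
    rfl
  · refine forall_congr' fun v => ?_
    simp only [true_imp_iff, hJ]
    refine forall_congr' fun hv => imp_congr_left ?_
    rw [hv.back_iff]
    push Not
    exact ⟨fun h j u hu hj hw => h u hu j hw hj, fun h u hu j hw hj => h j u hu hj hw⟩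

/-- `π^∩(χ)` says that, for some piece of evidence, `χ` holds at all its successors that are
also successors along `π`. -/
theorem sat_piCap (w : W) :
    (piCap d e).Sat M w ↔
      e.Sat M w ∧ ∃ R ∈ M.ev, ∀ v, R w v → Connected d M w v → e.Sat M v := by
  have hs := Form.isStaticSat (k := .upgrade) M
  refine and_congr_right fun _ => sat_bigDisj_exactly _ _ w fun J hJ => ?_
  refine exists_congr fun R => and_congr_right fun _ => forall_congr' fun v =>
    imp_congr_right fun _ => (hs.imp _ _ v).trans (imp_congr_left ?_)
  have hconj : ∀ a b : Form .upgrade, (Form.conj a b).Sat M v ↔ (a.Sat M v ∧ b.Sat M v) :=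
    fun _ _ => Iff.rfl
  simp only [hs.bigDisj, List.mem_map, exists_exists_and_eq_and, hconj, hs.ex,
    List.mem_filter, decide_eq_true_eq, hJ, ← exists_S0_iff_connected, sat_seqForm]
  constructor
  · exact fun ⟨s, ⟨h, hw⟩, ⟨_, _, hc⟩, hv⟩ => ⟨s, h, ⟨hw, hc⟩, hv⟩
  · exact fun ⟨s, h, ⟨hw, hc⟩, hv⟩ => ⟨s, ⟨h, hw⟩, ⟨w, hw, hc⟩, hv⟩

theorem upgrade_agg (hM : M.IsPreorders) {R : W → W → Prop} {x y : W} :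
    (M.upgrade R).agg x y ↔ (R x y ∧ ¬ R y x) ∨ (R x y ∧ M.agg x y) := by
  constructor
  · intro h
    by_cases hyx : R y x
    · have h' : ∀ S ∈ M.ev, R x y ∧ S x y := fun S hS =>
        (h _ ⟨S, hS, rfl⟩).resolve_left fun h => h.2 hyx
      exact .inr ⟨(h' _ hM.ev_nonempty.choose_spec).1, fun S hS => (h' S hS).2⟩
    · exact .inl ⟨(h _ ⟨_, hM.ev_nonempty.choose_spec, rfl⟩).elim And.left And.left, hyx⟩
  · rintro h _ ⟨S, hS, rfl⟩
    exact h.imp_right fun h => ⟨h.1, h.2 S hS⟩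

/-- The successors of `w` along `R^< ∪ (R ∩ S)`, where `R` is the closure of a program with the
normal form `d`. -/
theorem forall_upgrade_iff {R S : W → W → Prop} (hS : ∀ x, S x x)
    (hR : ∀ x y, R x y ↔ x = y ∨ Connected d M x y) (w : W) (P : W → Prop) :
    (∀ v, ((R w v ∧ ¬ R v w) ∨ (R w v ∧ S w v)) → P v) ↔
      P w ∧ (∀ v, Connected d M w v → ¬ (v = w ∨ Connected d M v w) → P v) ∧
        ∀ v, S w v → Connected d M w v → P v := by
  simp only [hR]
  constructor
  · exact fun h => ⟨h w (.inr ⟨.inl rfl, hS w⟩), fun v hv hv' => h v (.inl ⟨.inr hv, hv'⟩),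
      fun v hv hv' => h v (.inr ⟨.inr hv', hv⟩)⟩
  · rintro ⟨hw, h, h'⟩ v (⟨rfl | hv, hv'⟩ | ⟨rfl | hv, hv'⟩)
    · exact hw
    · exact h v hv hv'
    · exact hw
    · exact h' v hv' hv

end Upgrade

theorem UpgradeReduction.sound {N : Prog .upgrade → List (Form .upgrade × Form .upgrade) → Prop}
    (hN : ∀ r d, N r d → IsNF.{u} r d) {a : Form .upgrade} (h : UpgradeReduction N a)
    {W : Type u} (M : Model W) (hM : M.IsPreorders) (w : W) : a.Sat M w := by
  have hs := Form.isStaticSat (k := .upgrade) M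
  cases h with
  | eu1 r p => exact (hs.equ _ _ w).2 Iff.rfl
  | eu2 r c => exact (hs.equ _ _ w).2 Iff.rfl
  | eu3 r c c' => exact (hs.equ _ _ w).2 Iff.rfl
  | eu6 r c => exact (hs.equ _ _ w).2 Iff.rfl
  | eu4 r d c hd =>
    refine (hs.equ _ _ w).2 (Iff.trans ?_ (and_congr_right fun _ =>
      and_congr (sat_piLt w) (sat_piCap w)).symm)
    have key := fun S hS => forall_upgrade_iff (S := S) (hM.pre S hS).1 (hN r d hd M hM) w
      fun v => c.Sat (M.act .upgrade (Relation.ReflTransGen (r.Rel M))) v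
    constructor
    · rintro ⟨_, ⟨S, hS, rfl⟩, h⟩
      obtain ⟨h₁, h₂, h₃⟩ := (key S hS).1 h
      exact ⟨h₁, h₂, h₁, S, hS, h₃⟩
    · rintro ⟨h₁, h₂, -, S, hS, h₃⟩
      exact ⟨_, ⟨S, hS, rfl⟩, (key S hS).2 ⟨h₁, h₂, h₃⟩⟩
  | eu5 r d c hd =>
    refine (hs.equ _ _ w).2 (Iff.trans ?_ (and_congr_right fun _ => and_congr (sat_piLt w)
      (sat_bigConj_S0 (f := Form.box) (T := M.agg w)
        (fun a => Iff.rfl) _ fun s v => hs.imp _ _ v)).symm)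
    refine (forall_congr' fun v => imp_congr_left (upgrade_agg hM)).trans ?_
    exact forall_upgrade_iff (S := M.agg) (fun x R hR => (hM.pre R hR).1 x)
      (hN r d hd M hM) w _

/-! ### Completeness for addition and upgrade -/

namespace Form

variable {k : Action} {Red : Form k → Prop}

theorem sound (hred : ∀ a, Red a → ∀ {W : Type u} (M : Model W), M.IsPreorders → ∀ w, a.Sat M w)
    {a : Form k} (h : Theorem Form.dyn Red a) {W : Type u} (M : Model W) (hM : M.IsPreorders)
    (w : W) : a.Sat M w :=
  Theorem.sound (D := Form.dyn) (sat := Form.Sat) isStaticSat hred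
    (fun _ _ _ h _ _ hM w => h _ (hM.act k (isPre_reflTransGen _)) w) h M hM w

variable (Red) in
/-- Both members of each pair in `d` are reducible. -/
def ReducibleFamily (d : List (Form k × Form k)) : Prop :=
  ∀ p ∈ d, Reducible Form.dyn Red p.1 ∧ Reducible Form.dyn Red p.2

end Form

namespace Form.ReducibleFamily

variable {k : Action} {Red : Form k → Prop} {d : List (Form k × Form k)}
  (hd : ReducibleFamily Red d)

include hd

theorem phi (i : Fin d.length) : Reducible Form.dyn Red (phi d i) := (hd _ (d.get_mem i)).1

theorem psi (i : Fin d.length) : Reducible Form.dyn Red (psi d i) := (hd _ (d.get_mem i)).2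

theorem links (i : Fin d.length) (l : List (Fin d.length)) :
    ∀ a ∈ links d i l, Reducible Form.dyn Red a := by
  induction l generalizing i with
  | nil => simp [RelEv.links]
  | cons j l ih =>
    rw [RelEv.links, List.forall_mem_cons]
    exact ⟨((hd.psi i).conj (hd.phi j)).ex, ih j⟩

theorem seqForm (s : Fin d.length × List (Fin d.length)) :
    Reducible Form.dyn Red (seqForm d s) :=
  (hd.phi s.1).conj (.bigConj (hd.links s.1 s.2))

theorem seqEnd (s : Fin d.length × List (Fin d.length)) :
    Reducible Form.dyn Red (seqEnd d s) := hd.psi _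

theorem bigConj_S0 {g : Fin d.length × List (Fin d.length) → Form k}
    (hg : ∀ s, Reducible Form.dyn Red (g s)) :
    Reducible Form.dyn Red (bigConj ((S0 d.length).map fun s => imp (RelEv.seqForm d s) (g s))) :=
  .bigConj (List.forall_mem_map.2 fun s _ => (hd.seqForm s).imp (hg s))

end Form.ReducibleFamily

theorem Reducible.exactly {F ι : Type} [StaticOps F] {D : ι → F → F} {Red : F → Prop} {n : ℕ}
    {f : Fin n → F} (hf : ∀ i, Reducible D Red (f i)) (J : List (Fin n)) :
    Reducible D Red (exactly f J) :=
  .conj (.bigConj (List.forall_mem_map.2 fun i _ => hf i))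
    (.bigConj (List.forall_mem_map.2 fun i _ => (hf i).neg))

theorem reducible_piLt {Red : Form .upgrade → Prop} {d : List (Form .upgrade × Form .upgrade)}
    (hd : Form.ReducibleFamily Red d) {e : Form .upgrade} (he : Reducible Form.dyn Red e) :
    Reducible Form.dyn Red (piLt d e) :=
  .bigDisj (List.forall_mem_map.2 fun J _ => (Reducible.exactly hd.psi J).conj
    (hd.bigConj_S0 fun s => (((hd.seqEnd s).conj (hd.bigConj_S0 fun s' =>
      ((hd.seqEnd s').imp (.bigConj (List.forall_mem_map.2 fun j _ => (hd.phi j).neg))).all)).imp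
        he).all))

theorem reducible_piCap {Red : Form .upgrade → Prop} {d : List (Form .upgrade × Form .upgrade)}
    (hd : Form.ReducibleFamily Red d) {e : Form .upgrade} (he : Reducible Form.dyn Red e) :
    Reducible Form.dyn Red (piCap d e) :=
  he.conj (.bigDisj (List.forall_mem_map.2 fun J _ => (Reducible.exactly hd.phi J).conj
    (Reducible.box0 (.imp (.bigDisj (List.forall_mem_map.2 fun s _ =>
      (hd.seqForm s).ex.conj (hd.seqEnd s))) he))))

section Reduction

variable {k : Action} {Red : Form k → Prop}

mutual
/-- If the modality of each program with reducible tests can be eliminated, then all formulas are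
reducible, because the tests of a program occur in its normal form. -/
theorem Form.reducible
    (hdyn : ∀ r : Prog k, Form.ReducibleFamily Red r.normalForm.1 →
      ∀ a, Reducible Form.dyn Red a → Reducible Form.dyn Red (.dyn r a)) :
    ∀ a : Form k, Reducible Form.dyn Red a
  | .atom p => .atom p
  | .neg a => (a.reducible hdyn).neg
  | .conj a b => (a.reducible hdyn).conj (b.reducible hdyn)
  | .box0 a => (a.reducible hdyn).box0
  | .box a => (a.reducible hdyn).box
  | .all a => (a.reducible hdyn).all
  | .dyn r a => hdyn r (r.reducible_normalForm hdyn).1 a (a.reducible hdyn)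
theorem Prog.reducible_normalForm
    (hdyn : ∀ r : Prog k, Form.ReducibleFamily Red r.normalForm.1 →
      ∀ a, Reducible Form.dyn Red a → Reducible Form.dyn Red (.dyn r a)) :
    ∀ r : Prog k,
      Form.ReducibleFamily Red r.normalForm.1 ∧ Reducible Form.dyn Red r.normalForm.2
  | .univ => ⟨by simpa [Prog.normalForm, Form.ReducibleFamily] using .top, .bot⟩
  | .test a => ⟨by simpa [Prog.normalForm, Form.ReducibleFamily] using .bot, a.reducible hdyn⟩
  | .union r s =>
    ⟨List.forall_mem_append.2 ⟨(r.reducible_normalForm hdyn).1, (s.reducible_normalForm hdyn).1⟩,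
      (r.reducible_normalForm hdyn).2.disj (s.reducible_normalForm hdyn).2⟩
  | .seq r s => by
    obtain ⟨hr, hr'⟩ := r.reducible_normalForm hdyn
    obtain ⟨hs, hs'⟩ := s.reducible_normalForm hdyn
    refine ⟨List.forall_mem_append.2 ⟨List.forall_mem_append.2 ⟨?_, ?_⟩, ?_⟩, hr'.conj hs'⟩
    · refine List.forall_mem_flatMap.2 fun p hp => List.forall_mem_map.2 fun q hq => ?_
      exact ⟨(hr p hp).1.conj ((hr p hp).2.conj (hs q hq).1).ex, (hs q hq).2⟩
    · exact List.forall_mem_map.2 fun p hp => ⟨(hr p hp).1, (hr p hp).2.conj hs'⟩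
    · exact List.forall_mem_map.2 fun q hq => ⟨hr'.conj (hs q hq).1, (hs q hq).2⟩
  | .star r =>
    ⟨List.forall_mem_map.2 fun s _ =>
      ⟨(r.reducible_normalForm hdyn).1.seqForm s, (r.reducible_normalForm hdyn).1.seqEnd s⟩, .top⟩
end

end Reduction

theorem Form.reducible_add {N : Prog .add → List (Form .add × Form .add) → Prop}
    (hN : ∀ r d, ComputedNF r d → N r d) (a : Form .add) :
    Reducible Form.dyn (AddReduction N) a :=
  Form.reducible (fun r hr _ ha => .dyn r
    (fun p => .of_red (.ea1 r p) (.atom p))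
    (fun c h => .of_red (.ea2 r c) h.neg)
    (fun c c' h h' => .of_red (.ea3 r c c') (h.conj h'))
    (fun c h => .of_red (.ea4 r _ c (hN r _ rfl))
      (h.box0.disj (h.conj (hr.bigConj_S0 fun s => ((hr.seqEnd s).imp h).all))))
    (fun c h => .of_red (.ea5 r _ c (hN r _ rfl))
      (h.conj (hr.bigConj_S0 fun s => ((hr.seqEnd s).imp h).box)))
    (fun c h => .of_red (.ea6 r c) h.all) ha) a

theorem Form.reducible_upgrade
    {N : Prog .upgrade → List (Form .upgrade × Form .upgrade) → Prop}
    (hN : ∀ r d, ComputedNF r d → N r d) (a : Form .upgrade) :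
    Reducible Form.dyn (UpgradeReduction N) a :=
  Form.reducible (fun r hr _ ha => .dyn r
    (fun p => .of_red (.eu1 r p) (.atom p))
    (fun c h => .of_red (.eu2 r c) h.neg)
    (fun c c' h h' => .of_red (.eu3 r c c') (h.conj h'))
    (fun c h => .of_red (.eu4 r _ c (hN r _ rfl))
      (h.conj ((reducible_piLt hr h).conj (reducible_piCap hr h))))
    (fun c h => .of_red (.eu5 r _ c (hN r _ rfl))
      (h.conj ((reducible_piLt hr h).conj
        (hr.bigConj_S0 fun s => ((hr.seqEnd s).imp h).box))))
    (fun c h => .of_red (.eu6 r c) h.all) ha) a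

/-- Soundness and completeness for reduction axioms that are sound and reduce every formula. -/
theorem Form.theorem_iff_valid {k : Action} {Red : Form k → Prop}
    (hred : ∀ a, Red a → ∀ {W : Type u} (M : Model W), M.IsPreorders → ∀ w, a.Sat M w)
    (h : ∀ a, Reducible Form.dyn Red a) (a : Form k) :
    Theorem Form.dyn Red a ↔ Form.Valid.{u} a :=
  ⟨fun h _ M hM w => Form.sound hred h M hM.isPreorders w,
    (h a).theorem_of_valid (sat := Form.Sat) isStaticSat
      fun _ h _ M hM w => Form.sound hred h M hM w⟩

/-- Any class of normal forms between the computed ones and all of them will do. -/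
theorem addTheorem_iff_valid {N : Prog .add → List (Form .add × Form .add) → Prop}
    (hN : ∀ r d, ComputedNF r d → N r d) (hN' : ∀ r d, N r d → AnyNF.{u} r d) (a : Form .add) :
    AddTheorem N a ↔ Form.Valid.{u} a :=
  Form.theorem_iff_valid
    (fun _ h _ M hM w => h.sound (fun r d h => isNF_of_anyNF (hN' r d h)) M hM w)
    (Form.reducible_add hN) a

theorem upgradeTheorem_iff_valid {N : Prog .upgrade → List (Form .upgrade × Form .upgrade) → Prop}
    (hN : ∀ r d, ComputedNF r d → N r d) (hN' : ∀ r d, N r d → AnyNF.{u} r d)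
    (a : Form .upgrade) : UpgradeTheorem N a ↔ Form.Valid.{u} a :=
  Form.theorem_iff_valid
    (fun _ h _ M hM w => h.sound (fun r d h => isNF_of_anyNF (hN' r d h)) M hM w)
    (Form.reducible_upgrade hN) a

end RelEv

/-- The logics of public announcement, evidence addition and evidence upgrade are sound and
complete with respect to intersection models.  For addition and upgrade this is said both for the
system whose axioms use the computed normal forms only, and for the one whose axioms use every
normal form. -/
theorem theorem2 :
    (∀ a : RelEv.AnnForm, RelEv.AnnTheorem a ↔ RelEv.AnnForm.Valid.{u} a) ∧
    (∀ a : RelEv.Form .add,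
      RelEv.AddTheorem RelEv.ComputedNF a ↔ RelEv.Form.Valid.{u} a) ∧
    (∀ a : RelEv.Form .add,
      RelEv.AddTheorem RelEv.AnyNF.{u} a ↔ RelEv.Form.Valid.{u} a) ∧
    (∀ a : RelEv.Form .upgrade,
      RelEv.UpgradeTheorem RelEv.ComputedNF a ↔ RelEv.Form.Valid.{u} a) ∧
    (∀ a : RelEv.Form .upgrade,
      RelEv.UpgradeTheorem RelEv.AnyNF.{u} a ↔ RelEv.Form.Valid.{u} a) :=
  ⟨RelEv.annTheorem_iff_valid,
    RelEv.addTheorem_iff_valid (fun _ _ h => h) fun _ _ => RelEv.anyNF_of_computedNF,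
    RelEv.addTheorem_iff_valid (fun _ _ => RelEv.anyNF_of_computedNF) fun _ _ h => h,
    RelEv.upgradeTheorem_iff_valid (fun _ _ h => h) fun _ _ => RelEv.anyNF_of_computedNF,
    RelEv.upgradeTheorem_iff_valid (fun _ _ => RelEv.anyNF_of_computedNF) fun _ _ h => h⟩
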